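/- Let $k$ be a commutative unital ring and $G$ a group; algebras are associative $k$-algebras, not necessarily unital, and products of submodules denote the $k$-span of the products of elements. A $G$-graded algebra $A=\bigoplus_{t\in G}A_t$ is \emph{partially-strongly-graded} if $A_t=A_tA_{t^{-1}}A_t$ for all $t\in G$; put $D_t^A:=A_tA_{t^{-1}}$. \textbf{Strong-graded-equivalence.} Let $A$ and $B$ be idempotent $G$-graded algebras such that all $D_t^A$, $D_t^B$ are idempotent. A strong-graded-equivalence between $A$ and $B$ is a Morita context $\mathsf M=(A,B,X,Y,\tau_A,\tau_B)$, with unital bimodules ${}_AX_B$, ${}_BY_A$ and surjective bimodule maps $\tau_A:X\otimes_BY\to A$, $\tau_B:Y\otimes_AX\to B$, where $X=\bigoplus_tX_t$ and $Y=\bigoplus_tY_t$ are graded bimodules with $\tau_A(X_r\otimes Y_s)\subseteq A_{rs}$ and $\tau_B(Y_r\otimes X_s)\subseteq B_{rs}$, such that for every $t\in G$: $D_t^AX_t=X_t=X_tD_{t^{-1}}^B$, $D_t^BY_t=Y_t=Y_tD_{t^{-1}}^A$, $\tau_A(X_t\otimes Y_{t^{-1}})=D_t^A$ and $\tau_B(Y_t\otimes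 X_{t^{-1}})=D_t^B$. \textbf{Product partial actions.} A product partial action of $G$ on an algebra $S$ is a family of two-sided ideals $D_t$ of $S$ and algebra isomorphisms $\alpha_t:D_{t^{-1}}\to D_t$ such that $D_1=S$, $\alpha_1=\mathrm{id}$, $D_t^2=D_t$, $D_sD_t=D_tD_s$, $\alpha_s(D_{s^{-1}}D_t)=D_sD_{st}$, and $\alpha_s(\alpha_t(x))=\alpha_{st}(x)$ for $x\in D_{t^{-1}}D_{(st)^{-1}}$. Product partial actions $\alpha=(\{D_t\},\{\alpha_t\})$ on $S$ and $\alpha'=(\{D'_t\},\{\alpha'_t\})$ on $S'$ are \emph{Morita equivalent} if there are a Morita context $(S,S',X,Y,\tau_S,\tau_{S'})$ with unital bimodules and surjective trace maps, and a product partial action $\theta=(\{\bar D_t\},\{\theta_t\})$ on its context algebra $C=\begin{pmatrix}S&X\\Y&S'\end{pmatrix}$, such that $YD_tX=D'_t$ for all $t$, and $\theta|_S=\alpha$, $\theta|_{S'}=\alpha'$ (that is, $\bar D_t\cap S=D_t$, $\theta_t=\alpha_t$ on $D_{t^{-1}}$, and likewise for $S'$). \textbf{Canonical partial actions.} For a $G$-graded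 algebra $B$, the smash product $B\#G=\bigoplus_{r,s\in G}B_{r^{-1}s}e_{r,s}$ is an algebra of finitely supported $G\times G$-matrices over $B$, with the dual action $\beta^B_t(b\,e_{r,s})=b\,e_{tr,ts}$ of $G$. The partial smash product is its ideal $I^B=\bigoplus_{r,s\in G}B_{r^{-1}}B_se_{r,s}$, and $\gamma^B$ is the restriction of $\beta^B$ to $I^B$: its domains are $I^B\beta^B_t(I^B)$, and $\gamma^B_t(x)=\beta^B_t(x)$ for $x\in I^B\beta^B_{t^{-1}}(I^B)$. \textbf{Theorem.} Let $A$ and $B$ be partially-strongly-$G$-graded algebras and let $\mathsf M=(A,B,X,Y,\tau_A,\tau_B)$ be a strong-graded-equivalence between them. Then $\gamma^A$ on $I^A$ and $\gamma^B$ on $I^B$ are product partial actions of $G$, and they are Morita equivalent. -/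

import Mathlib

/-!
Conventions.  `k` is a commutative unital ring and `G` a group.  Algebras are associative
`k`-algebras, not necessarily unital.  For `k`-submodules `P`, `Q` and a bilinear map `f`,
`Submodule.map₂ f P Q` is the `k`-span of all `f p q` with `p ∈ P`, `q ∈ Q`; thus products such as
`A_s A_t`, `A_s X_t` or `τ(X_s ⊗ Y_t)` are all written with `Submodule.map₂`.
-/

universe uk uG uA uB uX uY

namespace GradedMorita

/-- The product `P Q` (finite sums of products) of two `k`-submodules of an algebra. -/
noncomputable def mulS {k A : Type*} [CommRing k] [NonUnitalRing A] [Module k A]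
    [IsScalarTower k A A] [SMulCommClass k A A] (P Q : Submodule k A) : Submodule k A :=
  Submodule.map₂ (LinearMap.mul k A) P Q

section Mul

variable {k A : Type*} [CommRing k] [NonUnitalRing A] [Module k A]
  [IsScalarTower k A A] [SMulCommClass k A A]

theorem mul_mem_mulS {P Q : Submodule k A} {a b : A} (ha : a ∈ P) (hb : b ∈ Q) :
    a * b ∈ mulS P Q :=
  Submodule.apply_mem_map₂ (LinearMap.mul k A) ha hb

theorem mulS_le {P Q R : Submodule k A} :
    mulS P Q ≤ R ↔ ∀ a ∈ P, ∀ b ∈ Q, a * b ∈ R :=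
  Submodule.map₂_le

end Mul

/-- A family of submodules is an internal direct sum decomposition of `M`: `M = ⊕ₜ Mₜ`. -/
structure IsDirectSum {k G M : Type*} [CommRing k] [AddCommGroup M] [Module k M]
    (V : G → Submodule k M) : Prop where
  indep : iSupIndep V
  iSup_eq : ⨆ t, V t = ⊤

/-- A `G`-grading `A = ⊕ₜ Aₜ`, `Aₛ Aₜ ⊆ Aₛₜ`, of a (possibly non-unital) algebra. -/
structure Grading (k G A : Type*) [CommRing k] [Group G] [NonUnitalRing A] [Module k A] where
  comp : G → Submodule k A
  isDirectSum : IsDirectSum comp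
  mul_mem : ∀ {s t : G} {a b : A}, a ∈ comp s → b ∈ comp t → a * b ∈ comp (s * t)

namespace Grading

variable {k G A : Type*} [CommRing k] [Group G] [NonUnitalRing A] [Module k A]
  [IsScalarTower k A A] [SMulCommClass k A A]

/-- The ideal `Dₜ = Aₜ Aₜ⁻¹` of `A₁`. -/
noncomputable def D (𝒜 : Grading k G A) (t : G) : Submodule k A :=
  mulS (𝒜.comp t) (𝒜.comp t⁻¹)

/-- `A` is partially-strongly-graded: `Aₜ = Aₜ Aₜ⁻¹ Aₜ` for all `t`. -/
def IsPartiallyStrong (𝒜 : Grading k G A) : Prop :=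
  ∀ t : G, mulS (mulS (𝒜.comp t) (𝒜.comp t⁻¹)) (𝒜.comp t) = 𝒜.comp t

end Grading

/-! ### Morita contexts -/

/-- A Morita context `(A, B, X, Y, τA, τB)`: `X` is an `(A, B)`-bimodule, `Y` is a
`(B, A)`-bimodule, and `τA : X ⊗_B Y → A`, `τB : Y ⊗_A X → B` are bimodule maps with
`τA(x ⊗ y) x' = x τB(y ⊗ x')` and `τB(y ⊗ x) y' = y τA(x ⊗ y')`.
A map out of `X ⊗_B Y` is given as the corresponding `B`-balanced bilinear map on `X × Y`. -/
structure MoritaContext (k A B X Y : Type*) [CommRing k]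
    [NonUnitalRing A] [Module k A] [NonUnitalRing B] [Module k B]
    [AddCommGroup X] [Module k X] [AddCommGroup Y] [Module k Y] where
  /-- left action of `A` on `X` -/
  AX : A →ₗ[k] X →ₗ[k] X
  /-- right action of `B` on `X` -/
  XB : X →ₗ[k] B →ₗ[k] X
  /-- left action of `B` on `Y` -/
  BY : B →ₗ[k] Y →ₗ[k] Y
  /-- right action of `A` on `Y` -/
  YA : Y →ₗ[k] A →ₗ[k] Y
  /-- trace map `X ⊗_B Y → A` -/
  τA : X →ₗ[k] Y →ₗ[k] A
  /-- trace map `Y ⊗_A X → B` -/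
  τB : Y →ₗ[k] X →ₗ[k] B
  mul_AX : ∀ a a' x, AX (a * a') x = AX a (AX a' x)
  XB_mul : ∀ x b b', XB x (b * b') = XB (XB x b) b'
  AX_XB : ∀ a x b, XB (AX a x) b = AX a (XB x b)
  mul_BY : ∀ b b' y, BY (b * b') y = BY b (BY b' y)
  YA_mul : ∀ y a a', YA y (a * a') = YA (YA y a) a'
  BY_YA : ∀ b y a, YA (BY b y) a = BY b (YA y a)
  τA_balanced : ∀ x b y, τA (XB x b) y = τA x (BY b y)
  τA_left : ∀ a x y, τA (AX a x) y = a * τA x y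
  τA_right : ∀ x y a, τA x (YA y a) = τA x y * a
  τB_balanced : ∀ y a x, τB (YA y a) x = τB y (AX a x)
  τB_left : ∀ b y x, τB (BY b y) x = b * τB y x
  τB_right : ∀ y x b, τB y (XB x b) = τB y x * b
  assoc_X : ∀ x y x', AX (τA x y) x' = XB x (τB y x')
  assoc_Y : ∀ y x y', BY (τB y x) y' = YA y (τA x y')

namespace MoritaContext

variable {k A B X Y : Type*} [CommRing k]
  [NonUnitalRing A] [Module k A] [NonUnitalRing B] [Module k B]
  [AddCommGroup X] [Module k X] [AddCommGroup Y] [Module k Y]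

/-- The context is a Morita equivalence: the modules `_A X`, `X_B`, `_B Y`, `Y_A` are unital
(`A X = X`, etc.) and the trace maps `X ⊗_B Y → A`, `Y ⊗_A X → B` are surjective. -/
structure IsMoritaEquivalence (M : MoritaContext k A B X Y) : Prop where
  AX_unital : Submodule.map₂ M.AX ⊤ ⊤ = ⊤
  XB_unital : Submodule.map₂ M.XB ⊤ ⊤ = ⊤
  BY_unital : Submodule.map₂ M.BY ⊤ ⊤ = ⊤
  YA_unital : Submodule.map₂ M.YA ⊤ ⊤ = ⊤
  τA_surj : Submodule.map₂ M.τA ⊤ ⊤ = ⊤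
  τB_surj : Submodule.map₂ M.τB ⊤ ⊤ = ⊤

/-- The context algebra: matrices `(a x; y b)`, stored as `(a, x, y, b)`, with the matrix
multiplication given by the context. -/
def ContextAlg (_M : MoritaContext k A B X Y) : Type _ := A × X × Y × B

namespace ContextAlg

variable {M : MoritaContext k A B X Y}

/-- The matrix `(a x; y b)`. -/
def mk (a : A) (x : X) (y : Y) (b : B) : M.ContextAlg := (a, x, y, b)

/-- The upper left entry. -/
def a (c : M.ContextAlg) : A := Prod.fst c
/-- The upper right entry. -/
def x (c : M.ContextAlg) : X := Prod.fst (Prod.snd c)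
/-- The lower left entry. -/
def y (c : M.ContextAlg) : Y := Prod.fst (Prod.snd (Prod.snd c))
/-- The lower right entry. -/
def b (c : M.ContextAlg) : B := Prod.snd (Prod.snd (Prod.snd c))

@[ext] theorem ext {c d : M.ContextAlg} (ha : c.a = d.a) (hx : c.x = d.x) (hy : c.y = d.y)
    (hb : c.b = d.b) : c = d :=
  Prod.ext ha (Prod.ext hx (Prod.ext hy hb))

instance : AddCommGroup M.ContextAlg := inferInstanceAs (AddCommGroup (A × X × Y × B))

instance : Module k M.ContextAlg := inferInstanceAs (Module k (A × X × Y × B))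

instance : Mul M.ContextAlg where
  mul c d := mk (c.a * d.a + M.τA c.x d.y) (M.AX c.a d.x + M.XB c.x d.b)
    (M.YA c.y d.a + M.BY c.b d.y) (M.τB c.y d.x + c.b * d.b)

@[simp] theorem mk_a (a : A) (x : X) (y : Y) (b : B) : (mk a x y b : M.ContextAlg).a = a := rfl
@[simp] theorem mk_x (a : A) (x : X) (y : Y) (b : B) : (mk a x y b : M.ContextAlg).x = x := rfl
@[simp] theorem mk_y (a : A) (x : X) (y : Y) (b : B) : (mk a x y b : M.ContextAlg).y = y := rfl
@[simp] theorem mk_b (a : A) (x : X) (y : Y) (b : B) : (mk a x y b : M.ContextAlg).b = b := rfl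
@[simp] theorem add_a (c d : M.ContextAlg) : (c + d).a = c.a + d.a := rfl
@[simp] theorem add_x (c d : M.ContextAlg) : (c + d).x = c.x + d.x := rfl
@[simp] theorem add_y (c d : M.ContextAlg) : (c + d).y = c.y + d.y := rfl
@[simp] theorem add_b (c d : M.ContextAlg) : (c + d).b = c.b + d.b := rfl
@[simp] theorem zero_a : (0 : M.ContextAlg).a = 0 := rfl
@[simp] theorem zero_x : (0 : M.ContextAlg).x = 0 := rfl
@[simp] theorem zero_y : (0 : M.ContextAlg).y = 0 := rfl
@[simp] theorem zero_b : (0 : M.ContextAlg).b = 0 := rfl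
@[simp] theorem smul_a (l : k) (c : M.ContextAlg) : (l • c).a = l • c.a := rfl
@[simp] theorem smul_x (l : k) (c : M.ContextAlg) : (l • c).x = l • c.x := rfl
@[simp] theorem smul_y (l : k) (c : M.ContextAlg) : (l • c).y = l • c.y := rfl
@[simp] theorem smul_b (l : k) (c : M.ContextAlg) : (l • c).b = l • c.b := rfl
@[simp] theorem mul_a (c d : M.ContextAlg) : (c * d).a = c.a * d.a + M.τA c.x d.y := rfl
@[simp] theorem mul_x (c d : M.ContextAlg) : (c * d).x = M.AX c.a d.x + M.XB c.x d.b := rfl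
@[simp] theorem mul_y (c d : M.ContextAlg) : (c * d).y = M.YA c.y d.a + M.BY c.b d.y := rfl
@[simp] theorem mul_b (c d : M.ContextAlg) : (c * d).b = M.τB c.y d.x + c.b * d.b := rfl

instance : NonUnitalRing M.ContextAlg :=
  { (inferInstance : AddCommGroup M.ContextAlg) with
    mul := (· * ·)
    left_distrib := by
      intro c d e
      ext <;> simp [mul_add] <;> abel
    right_distrib := by
      intro c d e
      ext <;> simp [add_mul] <;> abel
    zero_mul := by
      intro c
      ext <;> simp
    mul_zero := by
      intro c
      ext <;> simp
    mul_assoc := by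
      intro c d e
      ext <;> simp [add_mul, mul_add, mul_assoc,
        M.mul_AX, M.XB_mul, M.AX_XB, M.mul_BY, M.YA_mul, M.BY_YA, M.τA_balanced, M.τA_left,
        M.τA_right, M.τB_balanced, M.τB_left, M.τB_right, M.assoc_X, M.assoc_Y] <;> abel }

instance [IsScalarTower k A A] [IsScalarTower k B B] :
    IsScalarTower k M.ContextAlg M.ContextAlg where
  smul_assoc l c d := by
    ext <;> simp [smul_mul_assoc]

instance [SMulCommClass k A A] [SMulCommClass k B B] :
    SMulCommClass k M.ContextAlg M.ContextAlg where
  smul_comm l c d := by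
    ext <;> simp [mul_smul_comm]

end ContextAlg

/-- `A` as the upper left corner of the context algebra. -/
def inA (M : MoritaContext k A B X Y) : A →ₗ[k] M.ContextAlg where
  toFun a := ContextAlg.mk a 0 0 0
  map_add' a a' := by ext <;> simp
  map_smul' l a := by ext <;> simp

/-- `B` as the lower right corner of the context algebra. -/
def inB (M : MoritaContext k A B X Y) : B →ₗ[k] M.ContextAlg where
  toFun b := ContextAlg.mk 0 0 0 b
  map_add' b b' := by ext <;> simp
  map_smul' l b := by ext <;> simp

variable {G : Type*} [Group G]

/-- The context is graded by `𝒳` and `𝒴`: `X = ⊕ₜ Xₜ` and `Y = ⊕ₜ Yₜ` are graded bimodules and the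
trace maps respect the degrees. -/
structure IsGraded (M : MoritaContext k A B X Y) (𝒜 : Grading k G A) (ℬ : Grading k G B)
    (𝒳 : G → Submodule k X) (𝒴 : G → Submodule k Y) : Prop where
  isDirectSum_X : IsDirectSum 𝒳
  isDirectSum_Y : IsDirectSum 𝒴
  AX_mem : ∀ {s t : G} {a : A} {x : X}, a ∈ 𝒜.comp s → x ∈ 𝒳 t → M.AX a x ∈ 𝒳 (s * t)
  XB_mem : ∀ {s t : G} {x : X} {b : B}, x ∈ 𝒳 s → b ∈ ℬ.comp t → M.XB x b ∈ 𝒳 (s * t)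
  BY_mem : ∀ {s t : G} {b : B} {y : Y}, b ∈ ℬ.comp s → y ∈ 𝒴 t → M.BY b y ∈ 𝒴 (s * t)
  YA_mem : ∀ {s t : G} {y : Y} {a : A}, y ∈ 𝒴 s → a ∈ 𝒜.comp t → M.YA y a ∈ 𝒴 (s * t)
  τA_mem : ∀ {s t : G} {x : X} {y : Y}, x ∈ 𝒳 s → y ∈ 𝒴 t → M.τA x y ∈ 𝒜.comp (s * t)
  τB_mem : ∀ {s t : G} {y : Y} {x : X}, y ∈ 𝒴 s → x ∈ 𝒳 t → M.τB y x ∈ ℬ.comp (s * t)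

/-- The context is a strong-graded-equivalence between the graded algebras `A` and `B`. -/
structure IsStrongGradedEquivalence [IsScalarTower k A A] [SMulCommClass k A A]
    [IsScalarTower k B B] [SMulCommClass k B B]
    (M : MoritaContext k A B X Y) (𝒜 : Grading k G A) (ℬ : Grading k G B)
    (𝒳 : G → Submodule k X) (𝒴 : G → Submodule k Y) : Prop where
  -- `A`, `B` and all `Dₜ^A`, `Dₜ^B` are idempotent
  idem_A : mulS (⊤ : Submodule k A) ⊤ = ⊤
  idem_B : mulS (⊤ : Submodule k B) ⊤ = ⊤
  idem_DA : ∀ t, mulS (𝒜.D t) (𝒜.D t) = 𝒜.D t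
  idem_DB : ∀ t, mulS (ℬ.D t) (ℬ.D t) = ℬ.D t
  -- a graded Morita context with unital bimodules and surjective trace maps
  isGraded : M.IsGraded 𝒜 ℬ 𝒳 𝒴
  isMorita : M.IsMoritaEquivalence
  -- the context is strong: each `Xₜ` is a unital `(Dₜ^A, Dₜ⁻¹^B)`-bimodule and each `Yₜ` is a
  -- unital `(Dₜ^B, Dₜ⁻¹^A)`-bimodule
  DA_X : ∀ t, Submodule.map₂ M.AX (𝒜.D t) (𝒳 t) = 𝒳 t
  X_DB : ∀ t, Submodule.map₂ M.XB (𝒳 t) (ℬ.D t⁻¹) = 𝒳 t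
  DB_Y : ∀ t, Submodule.map₂ M.BY (ℬ.D t) (𝒴 t) = 𝒴 t
  Y_DA : ∀ t, Submodule.map₂ M.YA (𝒴 t) (𝒜.D t⁻¹) = 𝒴 t
  -- `τA(Xₜ ⊗ Yₜ⁻¹) = Dₜ^A` and `τB(Yₜ ⊗ Xₜ⁻¹) = Dₜ^B`
  τA_eq : ∀ t, Submodule.map₂ M.τA (𝒳 t) (𝒴 t⁻¹) = 𝒜.D t
  τB_eq : ∀ t, Submodule.map₂ M.τB (𝒴 t) (𝒳 t⁻¹) = ℬ.D t

end MoritaContext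

/-! ### Product partial actions -/

/-- The data of a partial action of `G` on `A`: domains `Dₜ` and linear maps `αₜ : Dₜ⁻¹ → A`. -/
structure PartialActionData (k G A : Type*) [CommRing k] [Group G] [NonUnitalRing A]
    [Module k A] where
  dom : G → Submodule k A
  act : ∀ t : G, dom t⁻¹ →ₗ[k] A

namespace PartialActionData

/-- The data form a product partial action. -/
structure IsProductPartialAction {k G A : Type*} [CommRing k] [Group G] [NonUnitalRing A]
    [Module k A] [IsScalarTower k A A] [SMulCommClass k A A]
    (α : PartialActionData k G A) : Prop where
  -- each `Dₜ` is a two-sided ideal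
  mul_mem_left : ∀ t (a d : A), d ∈ α.dom t → a * d ∈ α.dom t
  mul_mem_right : ∀ t (a d : A), d ∈ α.dom t → d * a ∈ α.dom t
  -- `αₜ` is an algebra isomorphism of `Dₜ⁻¹` onto `Dₜ`
  act_mul : ∀ t (x y z : α.dom t⁻¹), (z : A) = x * y → α.act t z = α.act t x * α.act t y
  act_injective : ∀ t, Function.Injective (α.act t)
  act_range : ∀ t, LinearMap.range (α.act t) = α.dom t
  -- `α₁` is the identity of `A`
  dom_one : α.dom 1 = ⊤
  act_one : ∀ x : α.dom 1⁻¹, α.act 1 x = x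
  -- `Dₜ² = Dₜ` and `Dₛ Dₜ = Dₜ Dₛ`
  dom_idem : ∀ t, mulS (α.dom t) (α.dom t) = α.dom t
  dom_comm : ∀ s t, mulS (α.dom s) (α.dom t) = mulS (α.dom t) (α.dom s)
  -- `αₛ(Dₛ⁻¹ Dₜ) = Dₛ Dₛₜ`; note that `Dₛ⁻¹ Dₜ ⊆ Dₛ⁻¹`
  act_dom : ∀ s t, ((mulS (α.dom s⁻¹) (α.dom t)).comap (α.dom s⁻¹).subtype).map (α.act s) =
    mulS (α.dom s) (α.dom (s * t))
  -- `αₛ(αₜ(x)) = αₛₜ(x)` for `x ∈ Dₜ⁻¹ D₍ₛₜ₎⁻¹`; here `y` is `αₜ(x)`, which lies in `Dₛ⁻¹` for these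
  -- `x` by the preceding condition, and `z` is `x` as an element of `D₍ₛₜ₎⁻¹`
  act_act : ∀ s t (x : α.dom t⁻¹) (y : α.dom s⁻¹) (z : α.dom (s * t)⁻¹),
    (x : A) ∈ mulS (α.dom t⁻¹) (α.dom (s * t)⁻¹) → (y : A) = α.act t x → (z : A) = x →
      α.act s y = α.act (s * t) z

/-- `(M, θ)` is a Morita equivalence between `α` and `β`: `M` is a Morita equivalence between `A`
and `B`, `θ` is a product partial action on the context algebra of `M`, with
(i) `Y Dₜ X = Dₜ'`, and (ii) `θ` restricts to `α` on `A` and to `β` on `B`. -/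
structure IsMoritaEquivalenceVia {k : Type uk} {G : Type uG} {A : Type uA} {B : Type uB}
    {X : Type uX} {Y : Type uY}
    [CommRing k] [Group G]
    [NonUnitalRing A] [Module k A] [IsScalarTower k A A] [SMulCommClass k A A]
    [NonUnitalRing B] [Module k B] [IsScalarTower k B B] [SMulCommClass k B B]
    [AddCommGroup X] [Module k X] [AddCommGroup Y] [Module k Y]
    (α : PartialActionData k G A) (β : PartialActionData k G B)
    (M : MoritaContext k A B X Y) (θ : PartialActionData k G M.ContextAlg) : Prop where
  isMorita : M.IsMoritaEquivalence
  isProductPartialAction : θ.IsProductPartialAction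
  Y_dom_X : ∀ t, Submodule.map₂ M.τB (Submodule.map₂ M.YA ⊤ (α.dom t)) ⊤ = β.dom t
  dom_A : ∀ t, (θ.dom t).comap M.inA = α.dom t
  dom_B : ∀ t, (θ.dom t).comap M.inB = β.dom t
  act_A : ∀ t (a : α.dom t⁻¹) (c : θ.dom t⁻¹), (c : M.ContextAlg) = M.inA (a : A) →
    θ.act t c = M.inA (α.act t a)
  act_B : ∀ t (b : β.dom t⁻¹) (c : θ.dom t⁻¹), (c : M.ContextAlg) = M.inB (b : B) →
    θ.act t c = M.inB (β.act t b)

/-- Product partial actions `α` on `A` and `β` on `B` are Morita equivalent.  The universes of the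
bimodules are explicit parameters of the definition. -/
def MoritaEquivalent {k : Type uk} {G : Type uG} {A : Type uA} {B : Type uB}
    [CommRing k] [Group G]
    [NonUnitalRing A] [Module k A] [IsScalarTower k A A] [SMulCommClass k A A]
    [NonUnitalRing B] [Module k B] [IsScalarTower k B B] [SMulCommClass k B B]
    (α : PartialActionData k G A) (β : PartialActionData k G B) : Prop :=
  α.IsProductPartialAction ∧ β.IsProductPartialAction ∧
  ∃ (X : Type uX) (Y : Type uY) (_ : AddCommGroup X) (_ : Module k X)
    (_ : AddCommGroup Y) (_ : Module k Y)
    (M : MoritaContext k A B X Y) (θ : PartialActionData k G M.ContextAlg),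
    IsMoritaEquivalenceVia α β M θ

end PartialActionData

/-! ### Restriction of a global action to an ideal -/

namespace PartialActionData

variable {k G S : Type*} [CommRing k] [Group G] [NonUnitalRing S] [Module k S]
  [IsScalarTower k S S] [SMulCommClass k S S]

/-- The inclusion of a subalgebra. -/
def incl (I : NonUnitalSubalgebra k S) : I →ₗ[k] S where
  toFun x := x.1
  map_add' _ _ := rfl
  map_smul' _ _ := rfl

/-- The product `I βₜ(I)`. -/
noncomputable def restrictIdeal (β : G → S →ₗ[k] S) (I : NonUnitalSubalgebra k S) (t : G) :
    Submodule k S :=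
  mulS I.toSubmodule (I.toSubmodule.map (β t))

theorem restrictIdeal_le (β : G → S →ₗ[k] S) (hmul : ∀ t x y, β t (x * y) = β t x * β t y)
    (hinv : ∀ t x, β t (β t⁻¹ x) = x) (I : NonUnitalSubalgebra k S)
    (hI : ∀ x y, y ∈ I → x * y ∈ I) (t : G) :
    restrictIdeal β I t⁻¹ ≤ I.toSubmodule.comap (β t) := by
  unfold restrictIdeal
  rw [mulS_le]
  rintro x _ _ ⟨y, hy, rfl⟩
  change β t (x * β t⁻¹ y) ∈ I
  rw [hmul, hinv]
  exact hI _ _ hy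

/-- The restriction to the ideal `I` of `S` of an action `β` of `G` on `S`: the domains are
`Dₜ = I βₜ(I)`, and `αₜ(x) = βₜ(x)` for `x ∈ Dₜ⁻¹`.  (The hypotheses are what is needed for `αₜ` to
take values in `I`.) -/
noncomputable def restrict (β : G → S →ₗ[k] S) (hmul : ∀ t x y, β t (x * y) = β t x * β t y)
    (hinv : ∀ t x, β t (β t⁻¹ x) = x) (I : NonUnitalSubalgebra k S)
    (hI : ∀ x y, y ∈ I → x * y ∈ I) : PartialActionData k G I where
  dom t := (restrictIdeal β I t).comap (incl I)
  act t :=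
    { toFun := fun x => ⟨β t x.1.1, restrictIdeal_le β hmul hinv I hI t x.2⟩
      map_add' := fun x y => Subtype.ext (map_add (β t) x.1.1 y.1.1)
      map_smul' := fun l x => Subtype.ext (map_smul (β t) l x.1.1) }

end PartialActionData

/-! ### Smash products -/

/-- `FMat_G(B)`: finitely supported `G × G`-matrices over `B`; `M r s` is the `(r, s)`-entry. -/
def FMat (G B : Type*) [NonUnitalRing B] : Type _ := G →₀ G →₀ B

namespace FMat

variable {k G B : Type*} [CommRing k] [NonUnitalRing B] [Module k B]

noncomputable instance : AddCommGroup (FMat G B) := inferInstanceAs (AddCommGroup (G →₀ G →₀ B))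

noncomputable instance : Module k (FMat G B) := inferInstanceAs (Module k (G →₀ G →₀ B))

/-- The entry of a matrix. -/
def entry (M : FMat G B) (r s : G) : B := (show G →₀ G →₀ B from M) r s

@[ext] theorem ext {M N : FMat G B} (h : ∀ r s, M.entry r s = N.entry r s) : M = N :=
  Finsupp.ext fun r => Finsupp.ext fun s => h r s

@[simp] theorem add_entry (M N : FMat G B) (r s : G) :
    (M + N).entry r s = M.entry r s + N.entry r s := rfl

@[simp] theorem zero_entry (r s : G) : (0 : FMat G B).entry r s = 0 := rfl

@[simp] theorem smul_entry (l : k) (M : FMat G B) (r s : G) :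
    (l • M).entry r s = l • M.entry r s := rfl

/-- The row `r` of the product is `∑ᵤ M(r,u) · (row u of N)`. -/
noncomputable instance : Mul (FMat G B) where
  mul M N := (show G →₀ G →₀ B from M).mapRange
    (fun row => row.sum fun u b =>
      ((show G →₀ G →₀ B from N) u).mapRange (fun c => b * c) (mul_zero b))
    Finsupp.sum_zero_index

/-- Matrix multiplication: `(M N)(r, s) = ∑ᵤ M(r, u) N(u, s)`. -/
theorem mul_entry (M N : FMat G B) (r s : G) :
    (M * N).entry r s = ((show G →₀ G →₀ B from M) r).sum fun u b => b * N.entry u s := by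
  change (((show G →₀ G →₀ B from M) r).sum fun u b =>
      ((show G →₀ G →₀ B from N) u).mapRange (fun c => b * c) (mul_zero b)) s = _
  rw [Finsupp.sum_apply]
  rfl

theorem mul_entry_eq_finsum (M N : FMat G B) (r s : G) :
    (M * N).entry r s = ∑ᶠ u, M.entry r u * N.entry u s := by
  rw [mul_entry, Finsupp.sum, finsum_eq_sum_of_support_subset]
  · rfl
  · intro u hu
    simp only [Function.mem_support] at hu
    simp only [Finset.mem_coe, Finsupp.mem_support_iff]
    intro h
    apply hu
    have : M.entry r u = 0 := h
    rw [this, zero_mul]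

noncomputable instance : NonUnitalRing (FMat G B) :=
  { (inferInstance : AddCommGroup (FMat G B)) with
    mul := (· * ·)
    left_distrib := by
      intro M N P
      ext r s
      simp only [add_entry, mul_entry, mul_add, Finsupp.sum_add]
    right_distrib := by
      intro M N P
      ext r s
      simp only [add_entry, mul_entry]
      exact Finsupp.sum_add_index' (fun u => zero_mul _) (fun u b c => add_mul _ _ _)
    zero_mul := by
      intro M
      ext r s
      rw [mul_entry]
      exact Finsupp.sum_zero_index
    mul_zero := by
      intro M
      ext r s
      rw [mul_entry]
      simp
    mul_assoc := by
      intro M N P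
      ext r s
      rw [mul_entry, mul_entry]
      change (((show G →₀ G →₀ B from M) r).sum fun u b =>
        ((show G →₀ G →₀ B from N) u).mapRange (fun c => b * c) (mul_zero b)).sum
          (fun v c => c * P.entry v s) = _
      rw [Finsupp.sum_sum_index (fun v => zero_mul _) (fun v b c => add_mul _ _ _)]
      refine Finsupp.sum_congr fun u _ => ?_
      rw [Finsupp.sum_mapRange_index (fun v => zero_mul _), mul_entry, Finsupp.mul_sum]
      simp only [mul_assoc] }

instance [IsScalarTower k B B] : IsScalarTower k (FMat G B) (FMat G B) where
  smul_assoc l M N := by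
    ext r s
    simp only [smul_eq_mul, smul_entry, mul_entry]
    rw [Finsupp.smul_sum]
    change (l • (show G →₀ G →₀ B from M) r).sum _ = _
    rw [Finsupp.sum_smul_index' (fun u => zero_mul _)]
    simp only [smul_mul_assoc]

instance [SMulCommClass k B B] : SMulCommClass k (FMat G B) (FMat G B) where
  smul_comm l M N := by
    ext r s
    simp only [smul_eq_mul, smul_entry, mul_entry, mul_smul_comm, Finsupp.smul_sum]

variable (k) in
/-- The action of `G` on matrices: `(t · M)(r, s) = M(t⁻¹ r, t⁻¹ s)`. -/
noncomputable def shift [Group G] (t : G) : FMat G B ≃ₗ[k] FMat G B :=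
  Finsupp.lcongr (Equiv.mulLeft t) (Finsupp.domLCongr (Equiv.mulLeft t))

theorem shift_entry [Group G] (t : G) (M : FMat G B) (r s : G) :
    (shift k t M).entry r s = M.entry (t⁻¹ * r) (t⁻¹ * s) := rfl

theorem shift_mul [Group G] (t : G) (M N : FMat G B) :
    shift k t (M * N) = shift k t M * shift k t N := by
  ext r s
  rw [shift_entry, mul_entry_eq_finsum, mul_entry_eq_finsum]
  simp only [shift_entry]
  exact (finsum_comp_equiv (Equiv.mulLeft t⁻¹)
    (f := fun u => M.entry (t⁻¹ * r) u * N.entry u (t⁻¹ * s))).symm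

end FMat

namespace Grading

variable {k G B : Type*} [CommRing k] [Group G] [NonUnitalRing B] [Module k B]

/-- `B # G = ⊕_{r,s} B_{r⁻¹s} e_{r,s}` as a subalgebra of `FMat_G(B)`. -/
noncomputable def smashSubalgebra (ℬ : Grading k G B) : NonUnitalSubalgebra k (FMat G B) where
  carrier := {M | ∀ r s, M.entry r s ∈ ℬ.comp (r⁻¹ * s)}
  add_mem' hM hN r s := (ℬ.comp _).add_mem (hM r s) (hN r s)
  zero_mem' r s := (ℬ.comp _).zero_mem
  smul_mem' l M hM r s := (ℬ.comp _).smul_mem l (hM r s)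
  mul_mem' {M N} hM hN r s := by
    rw [FMat.mul_entry]
    refine (ℬ.comp _).sum_mem fun u _ => ?_
    have h := ℬ.mul_mem (hM r u) (hN u s)
    have e : r⁻¹ * u * (u⁻¹ * s) = r⁻¹ * s := by group
    rw [e] at h
    exact h

/-- The smash product `B # G`, as an algebra. -/
def Smash (ℬ : Grading k G B) : Type _ := ℬ.smashSubalgebra

namespace Smash

variable {ℬ : Grading k G B}

noncomputable instance : NonUnitalRing ℬ.Smash :=
  inferInstanceAs (NonUnitalRing ℬ.smashSubalgebra)

noncomputable instance : Module k ℬ.Smash :=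
  inferInstanceAs (Module k ℬ.smashSubalgebra)

/-- The matrix underlying an element of `B # G`. -/
def mat (M : ℬ.Smash) : FMat G B := Subtype.val M

theorem entry_mem (M : ℬ.Smash) (r s : G) : M.mat.entry r s ∈ ℬ.comp (r⁻¹ * s) := M.2 r s

@[ext] theorem ext {M N : ℬ.Smash} (h : ∀ r s, M.mat.entry r s = N.mat.entry r s) : M = N :=
  Subtype.ext (FMat.ext h)

@[simp] theorem mat_add (M N : ℬ.Smash) : (M + N).mat = M.mat + N.mat := rfl

@[simp] theorem mat_zero : (0 : ℬ.Smash).mat = 0 := rfl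

@[simp] theorem mat_smul (l : k) (M : ℬ.Smash) : (l • M).mat = l • M.mat := rfl

@[simp] theorem mat_mul (M N : ℬ.Smash) : (M * N).mat = M.mat * N.mat := rfl

instance [IsScalarTower k B B] : IsScalarTower k ℬ.Smash ℬ.Smash where
  smul_assoc l M N := Subtype.ext (smul_mul_assoc l M.mat N.mat)

instance [SMulCommClass k B B] : SMulCommClass k ℬ.Smash ℬ.Smash where
  smul_comm l M N := Subtype.ext (mul_smul_comm l M.mat N.mat).symm

theorem mul_entry_mem {M N : ℬ.Smash} {P : Submodule k B} {r s : G}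
    (h : ∀ u, M.mat.entry r u * N.mat.entry u s ∈ P) : (M * N).mat.entry r s ∈ P := by
  rw [mat_mul, FMat.mul_entry]
  exact P.sum_mem fun u _ => h u

end Smash

theorem shift_mem_smash (ℬ : Grading k G B) (t : G) {M : FMat G B}
    (hM : M ∈ ℬ.smashSubalgebra) : FMat.shift k t M ∈ ℬ.smashSubalgebra := by
  intro r s
  have h := hM (t⁻¹ * r) (t⁻¹ * s)
  have e : (t⁻¹ * r)⁻¹ * (t⁻¹ * s) = r⁻¹ * s := by group
  rw [e] at h
  exact h

/-- The dual action `β^B` of `G` on `B # G`: `(βₜ M)(r, s) = M(t⁻¹ r, t⁻¹ s)`, that is,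
`βₜ(b e_{r,s}) = b e_{tr,ts}`. -/
noncomputable def dualAction (ℬ : Grading k G B) (t : G) : ℬ.Smash →ₗ[k] ℬ.Smash where
  toFun M := ⟨FMat.shift k t M.mat, ℬ.shift_mem_smash t M.2⟩
  map_add' M N := Subtype.ext (map_add (FMat.shift k t) M.mat N.mat)
  map_smul' l M := Subtype.ext (map_smul (FMat.shift k t) l M.mat)

theorem dualAction_entry (ℬ : Grading k G B) (t : G) (M : ℬ.Smash) (r s : G) :
    (ℬ.dualAction t M).mat.entry r s = M.mat.entry (t⁻¹ * r) (t⁻¹ * s) := rfl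

theorem dualAction_mul (ℬ : Grading k G B) (t : G) (M N : ℬ.Smash) :
    ℬ.dualAction t (M * N) = ℬ.dualAction t M * ℬ.dualAction t N :=
  Subtype.ext (FMat.shift_mul t M.mat N.mat)

theorem dualAction_dualAction_inv (ℬ : Grading k G B) (t : G) (M : ℬ.Smash) :
    ℬ.dualAction t (ℬ.dualAction t⁻¹ M) = M := by
  ext r s
  simp only [dualAction_entry, inv_inv, mul_inv_cancel_left]

variable [IsScalarTower k B B] [SMulCommClass k B B]

theorem mulS_mul_comp_mem (ℬ : Grading k G B) {p q r : G} {b c : B}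
    (hb : b ∈ mulS (ℬ.comp p) (ℬ.comp q)) (hc : c ∈ ℬ.comp r) :
    b * c ∈ mulS (ℬ.comp p) (ℬ.comp (q * r)) := by
  have : mulS (ℬ.comp p) (ℬ.comp q) ≤
      (mulS (ℬ.comp p) (ℬ.comp (q * r))).comap ((LinearMap.mul k B).flip c) := by
    rw [mulS_le]
    intro x hx y hy
    change x * y * c ∈ mulS (ℬ.comp p) (ℬ.comp (q * r))
    rw [mul_assoc]
    exact mul_mem_mulS hx (ℬ.mul_mem hy hc)
  exact this hb

theorem comp_mul_mulS_mem (ℬ : Grading k G B) {p q r : G} {b c : B}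
    (hc : c ∈ ℬ.comp r) (hb : b ∈ mulS (ℬ.comp p) (ℬ.comp q)) :
    c * b ∈ mulS (ℬ.comp (r * p)) (ℬ.comp q) := by
  have : mulS (ℬ.comp p) (ℬ.comp q) ≤
      (mulS (ℬ.comp (r * p)) (ℬ.comp q)).comap (LinearMap.mul k B c) := by
    rw [mulS_le]
    intro x hx y hy
    change c * (x * y) ∈ mulS (ℬ.comp (r * p)) (ℬ.comp q)
    rw [← mul_assoc]
    exact mul_mem_mulS (ℬ.mul_mem hc hx) hy
  exact this hb

/-- The partial smash product `I^B = ⊕_{r,s} B_{r⁻¹} B_s e_{r,s}`, as a subalgebra of `B # G`. -/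
noncomputable def partialSmash (ℬ : Grading k G B) : NonUnitalSubalgebra k ℬ.Smash where
  carrier := {M | ∀ r s, M.mat.entry r s ∈ mulS (ℬ.comp r⁻¹) (ℬ.comp s)}
  add_mem' hM hN r s := Submodule.add_mem _ (hM r s) (hN r s)
  zero_mem' _ _ := Submodule.zero_mem _
  smul_mem' l _ hM r s := Submodule.smul_mem _ l (hM r s)
  mul_mem' {M N} hM _ r s := by
    refine Smash.mul_entry_mem fun u => ?_
    have h := ℬ.mulS_mul_comp_mem (hM r u) (N.entry_mem u s)
    rwa [mul_inv_cancel_left] at h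

/-- `I^B` is a right ideal of `B # G`. -/
theorem partialSmash_mul_mem (ℬ : Grading k G B) (M N : ℬ.Smash) (hM : M ∈ ℬ.partialSmash) :
    M * N ∈ ℬ.partialSmash := by
  intro r s
  refine Smash.mul_entry_mem fun u => ?_
  have h := ℬ.mulS_mul_comp_mem (hM r u) (N.entry_mem u s)
  rwa [mul_inv_cancel_left] at h

/-- `I^B` is a left ideal of `B # G`. -/
theorem mul_mem_partialSmash (ℬ : Grading k G B) (M N : ℬ.Smash) (hN : N ∈ ℬ.partialSmash) :
    M * N ∈ ℬ.partialSmash := by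
  intro r s
  refine Smash.mul_entry_mem fun u => ?_
  have h := ℬ.comp_mul_mulS_mem (M.entry_mem r u) (hN u s)
  rwa [mul_inv_cancel_right] at h

/-- The canonical partial action `γ^B` of `G` on `I = I^B`: the restriction to `I` of the dual
action `β^B` on `B # G`. -/
noncomputable def canonicalPartialAction (ℬ : Grading k G B) :
    PartialActionData k G ℬ.partialSmash :=
  PartialActionData.restrict ℬ.dualAction ℬ.dualAction_mul ℬ.dualAction_dualAction_inv
    ℬ.partialSmash ℬ.mul_mem_partialSmash

end Grading

end GradedMorita

namespace GradedMorita

-- The context algebra `C = (A X; Y B)` is graded by `C_t = (A_t X_t; Y_t B_t)`, and the Morita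
-- equivalence is a decomposition of its canonical partial action `γ^C` into corners.
--
-- Two facts are needed. The first is that the canonical partial action of a
-- partially-strongly-graded algebra is a product partial action. The restriction of a global action
-- `β` to an idempotent ideal `I` is one as soon as `I` commutes with each `β_t(I)`, because all
-- domains are then products of the commuting idempotent ideals `J_t = β_t(I)`
-- (`restrict_isProductPartialAction`). For `I = I^B`, both `I β_t(I)` and `β_t(I) I` consist of the
-- matrices with entries in `B_{r⁻¹} B_t B_{t⁻¹} B_s`. Such products are computed by
-- `entriesIn_mul`: every middle index `u` of the matrix product contributes to the same submodule,
-- and `u = 1` already fills it.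
--
-- The second fact is that, in a strong context, the homogeneous pieces `P i j t` of the four
-- corners satisfy `P i j s ⋆ P j l t = P i i s ⋆ P i l t` (`IsMatrixRep.mul_eq`); for instance `X_s
-- Y_t = A_s A_t`. The reason is that the pieces of degree `1` compose like invertible bimodules.
-- Consequently `C` is partially-strongly-graded, and the upper left corner of `C_{r⁻¹} C_s` is
-- exactly `A_{r⁻¹} A_s`, with no larger contribution from `X_{r⁻¹} Y_s`. Hence `I^C` has diagonal
-- corners `I^A` and `I^B`, and its off-diagonal corners are the matrices with entries in `A_{r⁻¹}
-- X_s` and in `B_{r⁻¹} Y_s`.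
--
-- These corners form a Morita context whose context algebra is `I^C`, and `θ` is `γ^C` carried over
-- to it. The trace, unitality and restriction conditions become identities between families of
-- entries, again settled by `entriesIn_mul` and `mul_eq`.

local infixl:70 " ⋆ " => mulS

/-! ### Products of submodules. -/

section Products

variable {k A : Type*} [CommRing k] [NonUnitalRing A] [Module k A]
  [IsScalarTower k A A] [SMulCommClass k A A]

theorem mulS_mono {P P' Q Q' : Submodule k A} (hP : P ≤ P') (hQ : Q ≤ Q') : P ⋆ Q ≤ P' ⋆ Q' :=
  Submodule.map₂_le_map₂ hP hQ

theorem mulS_mulS_le {P Q R T : Submodule k A} :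
    P ⋆ Q ⋆ R ≤ T ↔ ∀ a ∈ P, ∀ b ∈ Q, ∀ c ∈ R, a * b * c ∈ T := by
  refine ⟨fun h a ha b hb c hc => h (mul_mem_mulS (mul_mem_mulS ha hb) hc), fun h => ?_⟩
  rw [mulS_le]
  intro x hx c hc
  have : P ⋆ Q ≤ T.comap ((LinearMap.mul k A).flip c) := by
    rw [mulS_le]
    exact fun a ha b hb => h a ha b hb c hc
  exact this hx

theorem mulS_assoc (P Q R : Submodule k A) : P ⋆ Q ⋆ R = P ⋆ (Q ⋆ R) := by
  apply le_antisymm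
  · rw [mulS_mulS_le]
    intro a ha b hb c hc
    rw [mul_assoc]
    exact mul_mem_mulS ha (mul_mem_mulS hb hc)
  · rw [mulS_le]
    intro a ha x hx
    have : Q ⋆ R ≤ (P ⋆ Q ⋆ R).comap (LinearMap.mul k A a) := by
      rw [mulS_le]
      intro b hb c hc
      change a * (b * c) ∈ P ⋆ Q ⋆ R
      rw [← mul_assoc]
      exact mul_mem_mulS (mul_mem_mulS ha hb) hc
    exact this hx

/-- A linear map which turns a bilinear map into multiplication turns spans of values into
products of submodules. -/
theorem map_map₂_eq_mulS {X Y Z : Type*} [AddCommGroup X] [Module k X] [AddCommGroup Y]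
    [Module k Y] [AddCommGroup Z] [Module k Z] {g : Z →ₗ[k] A} {f₁ : X →ₗ[k] A} {f₂ : Y →ₗ[k] A}
    {b : X →ₗ[k] Y →ₗ[k] Z} (h : ∀ x y, g (b x y) = f₁ x * f₂ y)
    (P : Submodule k X) (Q : Submodule k Y) :
    (Submodule.map₂ b P Q).map g = P.map f₁ ⋆ Q.map f₂ := by
  apply le_antisymm
  · rw [Submodule.map_le_iff_le_comap, Submodule.map₂_le]
    intro x hx y hy
    rw [Submodule.mem_comap, h]
    exact mul_mem_mulS (Submodule.mem_map_of_mem hx) (Submodule.mem_map_of_mem hy)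
  · rw [mulS_le]
    rintro _ ⟨x, hx, rfl⟩ _ ⟨y, hy, rfl⟩
    rw [← h]
    exact Submodule.mem_map_of_mem (Submodule.apply_mem_map₂ _ hx hy)

theorem map_mulS {A' : Type*} [NonUnitalRing A'] [Module k A']
    [IsScalarTower k A' A'] [SMulCommClass k A' A'] {f : A' →ₗ[k] A}
    (h : ∀ x y, f (x * y) = f x * f y) (P Q : Submodule k A') :
    (P ⋆ Q).map f = P.map f ⋆ Q.map f :=
  map_map₂_eq_mulS h P Q

end Products

/-! ### Identities for partial representations by submodules. -/

section PartialRepresentation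

variable {k G A : Type*} [CommRing k] [Group G] [NonUnitalRing A] [Module k A]
  [IsScalarTower k A A] [SMulCommClass k A A]

/-- A family of submodules with `Pₛ Pₜ ⊆ Pₛₜ` and `Pₜ Pₜ⁻¹ Pₜ = Pₜ`. -/
structure IsPartialRep (P : G → Submodule k A) : Prop where
  mul_le : ∀ s t, P s ⋆ P t ≤ P (s * t)
  mul_inv_mul : ∀ t, P t ⋆ P t⁻¹ ⋆ P t = P t

namespace IsPartialRep

variable {P : G → Submodule k A} (h : IsPartialRep P)
include h

theorem mul_le_of_eq {s t u : G} (e : s * t = u) : P s ⋆ P t ≤ P u :=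
  e ▸ h.mul_le s t

/-- No unit element is assumed; `P 1` acts as an identity because the factor `P t ⋆ P t⁻¹` of `P t`
lies in `P 1`. -/
theorem one_mul (t : G) : P 1 ⋆ P t = P t := by
  refine le_antisymm (h.mul_le_of_eq (_root_.one_mul t)) ?_
  conv_lhs => rw [← h.mul_inv_mul t]
  exact mulS_mono (h.mul_le_of_eq (mul_inv_cancel t)) le_rfl

theorem mul_one (t : G) : P t ⋆ P 1 = P t := by
  refine le_antisymm (h.mul_le_of_eq (_root_.mul_one t)) ?_
  conv_lhs => rw [← h.mul_inv_mul t, mulS_assoc]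
  exact mulS_mono le_rfl (h.mul_le_of_eq (inv_mul_cancel t))

/-- In the presence of `P t⁻¹` on the right, the product `P s ⋆ P t` loses nothing against `P (s *
t)`: expanding `P t⁻¹ = P t⁻¹ ⋆ P t ⋆ P t⁻¹` lets `P (s * t) ⋆ P t⁻¹` be absorbed into `P s`. The
next lemma is the mirror image. -/
theorem mul_mul_inv (s t : G) : P s ⋆ (P t ⋆ P t⁻¹) = P (s * t) ⋆ P t⁻¹ := by
  apply le_antisymm
  · rw [← mulS_assoc]
    exact mulS_mono (h.mul_le s t) le_rfl
  · have := h.mul_inv_mul t⁻¹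
    rw [inv_inv] at this
    conv_lhs => rw [← this]
    rw [mulS_assoc, ← mulS_assoc]
    exact mulS_mono (h.mul_le_of_eq (mul_inv_cancel_right s t)) le_rfl

theorem mul_inv_mul_mul (s t : G) : P t ⋆ (P t⁻¹ ⋆ P s) = P t ⋆ P (t⁻¹ * s) := by
  apply le_antisymm
  · exact mulS_mono le_rfl (h.mul_le _ _)
  · conv_lhs => rw [← h.mul_inv_mul t]
    rw [mulS_assoc, mulS_assoc]
    exact mulS_mono le_rfl (mulS_mono le_rfl (h.mul_le_of_eq (mul_inv_cancel_left t s)))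

end IsPartialRep

end PartialRepresentation

/-! ### Matrices with prescribed entries in the smash product, and the domains of `γ^B`. -/

namespace Grading

variable {k G B : Type*} [CommRing k] [Group G] [NonUnitalRing B] [Module k B]

namespace Smash

variable {ℬ : Grading k G B}

variable (ℬ) in
/-- The elements of `B # G` with entries in prescribed submodules. -/
def entriesIn (W : G → G → Submodule k B) : Submodule k ℬ.Smash where
  carrier := {M | ∀ r s, M.mat.entry r s ∈ W r s}
  add_mem' hM hN r s := (W r s).add_mem (hM r s) (hN r s)
  zero_mem' r s := (W r s).zero_mem
  smul_mem' l _ hM r s := (W r s).smul_mem l (hM r s)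

omit [Group G] in
open Classical in
theorem single_entry (r s : G) (b : B) (r' s' : G) :
    FMat.entry (Finsupp.single r (Finsupp.single s b)) r' s' =
      if r = r' then if s = s' then b else 0 else 0 := by
  change (Finsupp.single r (Finsupp.single s b) : G →₀ G →₀ B) r' s' = _
  rw [Finsupp.single_apply]
  split_ifs with h1 h2
  · subst h2
    simp
  · simp [h2]
  · rfl

/-- The matrix `b e_{r,s}`. -/
noncomputable def single (r s : G) (b : B) (hb : b ∈ ℬ.comp (r⁻¹ * s)) : ℬ.Smash :=
  ⟨Finsupp.single r (Finsupp.single s b), by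
    classical
    intro r' s'
    rw [single_entry]
    split_ifs with h1 h2
    · subst h1 h2
      exact hb
    · exact zero_mem _
    · exact zero_mem _⟩

open Classical in
theorem single_mat_entry (r s : G) (b : B) (hb : b ∈ ℬ.comp (r⁻¹ * s)) (r' s' : G) :
    (single r s b hb).mat.entry r' s' = if r = r' then if s = s' then b else 0 else 0 :=
  single_entry r s b r' s'

theorem single_mem {W : G → G → Submodule k B} {r s : G} {b : B} (hb : b ∈ ℬ.comp (r⁻¹ * s))
    (h : b ∈ W r s) : single r s b hb ∈ entriesIn ℬ W := by
  classical
  intro r' s'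
  rw [single_mat_entry]
  split_ifs with h1 h2
  · subst h1 h2
    exact h
  · exact zero_mem _
  · exact zero_mem _

theorem single_mul_single {r u s : G} {b c : B} (hb : b ∈ ℬ.comp (r⁻¹ * u))
    (hc : c ∈ ℬ.comp (u⁻¹ * s)) (hbc : b * c ∈ ℬ.comp (r⁻¹ * s)) :
    single r u b hb * single u s c hc = single r s (b * c) hbc := by
  classical
  ext r' s'
  rw [mat_mul, FMat.mul_entry_eq_finsum, finsum_eq_single _ u]
  · simp only [single_mat_entry, if_true]
    split_ifs <;> simp
  · intro v hv
    simp only [single_mat_entry]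
    split_ifs <;> simp_all

variable (ℬ) in
/-- The linear map `b ↦ b e_{r,s}`. -/
noncomputable def singleₗ (r s : G) : ℬ.comp (r⁻¹ * s) →ₗ[k] ℬ.Smash where
  toFun b := single r s b.1 b.2
  map_add' b c := by
    classical
    ext r' s'
    rw [mat_add, FMat.add_entry]
    simp only [single_mat_entry, Submodule.coe_add]
    split_ifs <;> simp
  map_smul' l b := by
    classical
    ext r' s'
    rw [RingHom.id_apply, mat_smul, FMat.smul_entry]
    simp only [single_mat_entry, Submodule.coe_smul]
    split_ifs <;> simp

/-- By finite support a matrix is the finite sum of its `b e_{r,s}`, so an inclusion need only be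
tested on these. -/
theorem entriesIn_le {W : G → G → Submodule k B} {N : Submodule k ℬ.Smash}
    (hN : ∀ r s b, b ∈ W r s → ∀ hb : b ∈ ℬ.comp (r⁻¹ * s), single r s b hb ∈ N) :
    entriesIn ℬ W ≤ N := by
  intro M hM
  have key : M = ∑ r ∈ Finsupp.support (show G →₀ G →₀ B from M.mat),
      ∑ s ∈ Finsupp.support ((show G →₀ G →₀ B from M.mat) r),
        single r s (M.mat.entry r s) (M.entry_mem r s) := by
    -- The decomposition is verified on the underlying finitely supported functions.
    let v : ℬ.Smash →+ (G →₀ G →₀ B) :=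
      { toFun := fun M => M.mat
        map_zero' := rfl
        map_add' := fun _ _ => rfl }
    have hv : Function.Injective v := Subtype.val_injective
    apply hv
    rw [map_sum]
    simp only [map_sum]
    change v M = ∑ r ∈ (v M).support, ∑ s ∈ ((v M) r).support,
      Finsupp.single r (Finsupp.single s (v M r s))
    conv_lhs => rw [← Finsupp.sum_single (v M)]
    refine Finset.sum_congr rfl fun r _ => ?_
    rw [← Finsupp.single_finsetSum]
    congr 1
    exact (Finsupp.sum_single (v M r)).symm
  rw [key]
  exact N.sum_mem fun r _ => N.sum_mem fun s _ => hN r s _ (hM r s) _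

theorem map_dualAction_entriesIn (t : G) (W : G → G → Submodule k B) :
    (entriesIn ℬ W).map (ℬ.dualAction t) =
      entriesIn ℬ fun r s => W (t⁻¹ * r) (t⁻¹ * s) := by
  ext M
  constructor
  · rintro ⟨N, hN, rfl⟩ r s
    exact hN _ _
  · intro hM
    refine ⟨ℬ.dualAction t⁻¹ M, fun r s => ?_, ℬ.dualAction_dualAction_inv t M⟩
    have := hM (t * r) (t * s)
    simpa [dualAction_entry] using this

variable [IsScalarTower k B B] [SMulCommClass k B B]

/-- The tool for all ideal products below. The upper bound must hold for every middle index `u`,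
whereas the lower bound asks only that the index `1` reach all of `U r s`; it is then realised by
products `(x e_{r,1}) (y e_{1,s})`. -/
theorem entriesIn_mul {U V W : G → G → Submodule k B}
    (hV : ∀ r s, V r s ≤ ℬ.comp (r⁻¹ * s)) (hW : ∀ r s, W r s ≤ ℬ.comp (r⁻¹ * s))
    (h₁ : ∀ r u s, V r u ⋆ W u s ≤ U r s) (h₂ : ∀ r s, U r s ≤ V r 1 ⋆ W 1 s) :
    entriesIn ℬ V ⋆ entriesIn ℬ W = entriesIn ℬ U := by
  apply le_antisymm
  · rw [mulS_le]
    intro M hM N hN r s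
    exact mul_entry_mem fun u => h₁ r u s (mul_mem_mulS (hM r u) (hN u s))
  · apply entriesIn_le
    intro r s b hb
    have hVW : V r 1 ⋆ W 1 s ≤ ℬ.comp (r⁻¹ * s) := by
      rw [mulS_le]
      intro x hx y hy
      have := ℬ.mul_mem (hV _ _ hx) (hW _ _ hy)
      simpa using this
    -- The matrix `b e_{r,s}` exists only for `b` of degree `r⁻¹ s`, so the argument over the span
    -- takes place inside that component, where `b ↦ b e_{r,s}` is linear.
    have : V r 1 ⋆ W 1 s ≤ ((entriesIn ℬ V ⋆ entriesIn ℬ W).comap (singleₗ ℬ r s)).map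
        (ℬ.comp (r⁻¹ * s)).subtype := by
      rw [mulS_le]
      intro x hx y hy
      refine ⟨⟨x * y, hVW (mul_mem_mulS hx hy)⟩, ?_, rfl⟩
      change single r s (x * y) (hVW (mul_mem_mulS hx hy)) ∈ entriesIn ℬ V ⋆ entriesIn ℬ W
      rw [← single_mul_single (hV _ _ hx) (hW _ _ hy)]
      exact mul_mem_mulS (single_mem _ hx) (single_mem _ hy)
    obtain ⟨c, hc, rfl⟩ := this (h₂ r s hb)
    intro _
    exact hc

end Smash

variable [IsScalarTower k B B] [SMulCommClass k B B]

theorem IsPartiallyStrong.isPartialRep {ℬ : Grading k G B} (h : ℬ.IsPartiallyStrong) :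
    IsPartialRep ℬ.comp where
  mul_le _ _ := mulS_le.2 fun _ ha _ hb => ℬ.mul_mem ha hb
  mul_inv_mul := h

theorem mulS_comp_le (ℬ : Grading k G B) {s t u : G} (e : s * t = u) :
    ℬ.comp s ⋆ ℬ.comp t ≤ ℬ.comp u :=
  mulS_le.2 fun _ ha _ hb => e ▸ ℬ.mul_mem ha hb

theorem partialSmash_toSubmodule (ℬ : Grading k G B) :
    ℬ.partialSmash.toSubmodule = Smash.entriesIn ℬ fun r s => ℬ.comp r⁻¹ ⋆ ℬ.comp s := rfl

theorem map_dualAction_partialSmash (ℬ : Grading k G B) (t : G) :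
    ℬ.partialSmash.toSubmodule.map (ℬ.dualAction t) =
      Smash.entriesIn ℬ fun r s => ℬ.comp (r⁻¹ * t) ⋆ ℬ.comp (t⁻¹ * s) := by
  rw [partialSmash_toSubmodule, Smash.map_dualAction_entriesIn]
  simp only [mul_inv_rev, inv_inv]

section

variable {ℬ : Grading k G B} (h : ℬ.IsPartiallyStrong)
include h

/-- The middle index `u` contributes `B_{r⁻¹} B_u B_{u⁻¹t} B_{t⁻¹s}`, which lies in `B_{r⁻¹} B_t
B_{t⁻¹s}`, with equality at `u = 1`; and `B_t B_{t⁻¹s} = B_t B_{t⁻¹} B_s` by the partial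
representation identities. -/
theorem IsPartiallyStrong.restrictIdeal_eq (t : G) :
    PartialActionData.restrictIdeal ℬ.dualAction ℬ.partialSmash t =
      Smash.entriesIn ℬ fun r s => ℬ.comp r⁻¹ ⋆ (ℬ.comp t ⋆ (ℬ.comp t⁻¹ ⋆ ℬ.comp s)) := by
  have hP := h.isPartialRep
  unfold PartialActionData.restrictIdeal
  rw [map_dualAction_partialSmash, partialSmash_toSubmodule]
  apply Smash.entriesIn_mul
  · exact fun r s => ℬ.mulS_comp_le rfl
  · exact fun r s => ℬ.mulS_comp_le (by group)
  · intro r u s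
    rw [hP.mul_inv_mul_mul, mulS_assoc, ← mulS_assoc (ℬ.comp u)]
    exact mulS_mono le_rfl (mulS_mono (ℬ.mulS_comp_le (by group)) le_rfl)
  · intro r s
    rw [hP.mul_inv_mul_mul, hP.mul_one, inv_one, _root_.one_mul]

/-- The same family of entries arises from the product in the opposite order, now through `B_{r⁻¹}
B_t B_{t⁻¹} = B_{r⁻¹t} B_{t⁻¹}`. Hence `I` and `β_t(I)` commute. -/
theorem IsPartiallyStrong.map_dualAction_mulS (t : G) :
    ℬ.partialSmash.toSubmodule.map (ℬ.dualAction t) ⋆ ℬ.partialSmash.toSubmodule =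
      Smash.entriesIn ℬ fun r s => ℬ.comp r⁻¹ ⋆ (ℬ.comp t ⋆ (ℬ.comp t⁻¹ ⋆ ℬ.comp s)) := by
  have hP := h.isPartialRep
  rw [map_dualAction_partialSmash, partialSmash_toSubmodule]
  have e : ∀ r s, ℬ.comp r⁻¹ ⋆ (ℬ.comp t ⋆ (ℬ.comp t⁻¹ ⋆ ℬ.comp s)) =
      ℬ.comp (r⁻¹ * t) ⋆ (ℬ.comp t⁻¹ ⋆ ℬ.comp s) := by
    intro r s
    rw [← mulS_assoc (ℬ.comp t), ← mulS_assoc, hP.mul_mul_inv, mulS_assoc]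
  apply Smash.entriesIn_mul
  · exact fun r s => ℬ.mulS_comp_le (by group)
  · exact fun r s => ℬ.mulS_comp_le rfl
  · intro r u s
    rw [e, mulS_assoc, ← mulS_assoc (ℬ.comp (t⁻¹ * u))]
    exact mulS_mono le_rfl (mulS_mono (ℬ.mulS_comp_le (by group)) le_rfl)
  · intro r s
    rw [e, inv_one, hP.one_mul, _root_.mul_one, mulS_assoc]

theorem IsPartiallyStrong.partialSmash_idem :
    ℬ.partialSmash.toSubmodule ⋆ ℬ.partialSmash.toSubmodule = ℬ.partialSmash.toSubmodule := by
  have hP := h.isPartialRep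
  rw [partialSmash_toSubmodule]
  apply Smash.entriesIn_mul
  · exact fun r s => ℬ.mulS_comp_le rfl
  · exact fun r s => ℬ.mulS_comp_le rfl
  · intro r u s
    rw [mulS_assoc]
    exact mulS_mono le_rfl
      ((mulS_mono le_rfl (ℬ.mulS_comp_le rfl)).trans (ℬ.mulS_comp_le (by group)))
  · intro r s
    rw [inv_one, hP.mul_one, hP.one_mul]

end

end Grading

/-! ### Restriction of a global action to an idempotent ideal. -/

namespace PartialActionData

section Restrict

variable {k G S : Type*} [CommRing k] [Group G] [NonUnitalRing S] [Module k S]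

theorem incl_injective (I : NonUnitalSubalgebra k S) : Function.Injective (incl I) :=
  Subtype.val_injective

theorem incl_mul (I : NonUnitalSubalgebra k S) (x y : I) : incl I (x * y) = incl I x * incl I y :=
  rfl

theorem map_comap_incl {I : NonUnitalSubalgebra k S} {J : Submodule k S}
    (hJ : J ≤ I.toSubmodule) : (J.comap (incl I)).map (incl I) = J := by
  apply le_antisymm (Submodule.map_comap_le _ _)
  intro x hx
  exact ⟨⟨x, hJ hx⟩, hx, rfl⟩

theorem eq_of_map_incl_eq {I : NonUnitalSubalgebra k S} {J K : Submodule k I}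
    (h : J.map (incl I) = K.map (incl I)) : J = K :=
  Submodule.map_injective_of_injective (incl_injective I) h

variable [IsScalarTower k S S] [SMulCommClass k S S]

theorem map_incl_mulS_comap {I : NonUnitalSubalgebra k S} {J K : Submodule k S}
    (hJ : J ≤ I.toSubmodule) (hK : K ≤ I.toSubmodule) :
    (J.comap (incl I) ⋆ K.comap (incl I)).map (incl I) = J ⋆ K := by
  rw [map_mulS (incl_mul I), map_comap_incl hJ, map_comap_incl hK]

/-- Let `I` be an idempotent ideal of `S` and `β` an action of `G` on `S` by automorphisms such that
`I βₜ(I) = βₜ(I) I` for all `t`.  Then `β` restricts to a product partial action on `I`. -/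
theorem restrict_isProductPartialAction (β : G → S →ₗ[k] S)
    (hmul : ∀ t x y, β t (x * y) = β t x * β t y) (hinv : ∀ t x, β t (β t⁻¹ x) = x)
    (hβ : ∀ s t x, β s (β t x) = β (s * t) x)
    (I : NonUnitalSubalgebra k S) (hI : ∀ x y, y ∈ I → x * y ∈ I) (hI' : ∀ x y, x ∈ I → x * y ∈ I)
    (hidem : I.toSubmodule ⋆ I.toSubmodule = I.toSubmodule)
    (hcomm : ∀ t, I.toSubmodule ⋆ I.toSubmodule.map (β t) =
      I.toSubmodule.map (β t) ⋆ I.toSubmodule) :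
    (restrict β hmul hinv I hI).IsProductPartialAction := by
  have hone : ∀ x, β 1 x = x := by
    intro x
    have h := hinv 1 x
    rwa [hβ, inv_one, mul_one] at h
  have hmap : ∀ t (P Q : Submodule k S), (P ⋆ Q).map (β t) = P.map (β t) ⋆ Q.map (β t) :=
    fun t => map_mulS (hmul t)
  -- The translates `J t` of `I` are permuted by the action, are idempotent and commute with one
  -- another; the axioms on the domains reduce to this calculus.
  set J : G → Submodule k S := fun t => I.toSubmodule.map (β t) with hJdef
  have hmapJ : ∀ s t, (J t).map (β s) = J (s * t) := by
    intro s t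
    ext x
    constructor
    · rintro ⟨_, ⟨y, hy, rfl⟩, rfl⟩
      exact ⟨y, hy, (hβ s t y).symm⟩
    · rintro ⟨y, hy, rfl⟩
      exact ⟨β t y, ⟨y, hy, rfl⟩, hβ s t y⟩
  have hJ1 : J 1 = I.toSubmodule := by
    ext x
    constructor
    · rintro ⟨y, hy, rfl⟩
      rwa [hone]
    · exact fun hx => ⟨x, hx, hone x⟩
  have hcommJ : ∀ s t, J s ⋆ J t = J t ⋆ J s := by
    intro s t
    -- Translation by `β s` of the fact that `I` commutes with `J (s⁻¹ * t)`.
    have h := congrArg (Submodule.map (β s)) (hcomm (s⁻¹ * t))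
    rw [hmap, hmap] at h
    change J s ⋆ (J (s⁻¹ * t)).map (β s) = (J (s⁻¹ * t)).map (β s) ⋆ J s at h
    rwa [hmapJ, mul_inv_cancel_left] at h
  have hidemJ : ∀ t, J t ⋆ J t = J t := by
    intro t
    rw [← hmap, hidem]
  set E : G → Submodule k S := restrictIdeal β I with hEdef
  have hE : ∀ t, E t = J 1 ⋆ J t := fun t => by rw [hJ1]; rfl
  have hEI : ∀ t, E t ≤ I.toSubmodule := by
    intro t
    rw [hEdef]
    exact mulS_le.2 fun x hx y _ => hI' x y hx
  have hEmap : ∀ t, (E t⁻¹).map (β t) = E t := by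
    intro t
    rw [hE, hE, hmap, hmapJ, hmapJ, mul_inv_cancel, mul_one, hcommJ]
  have hEE : ∀ s t, E s ⋆ E t = J 1 ⋆ (J s ⋆ J t) := by
    intro s t
    rw [hE, hE, mulS_assoc, ← mulS_assoc (J s), hcommJ s 1, mulS_assoc, ← mulS_assoc (J 1) (J 1),
      hidemJ]
  have hleft : ∀ t x y, y ∈ E t → x * y ∈ E t := by
    intro t x y hy
    have hle : E t ≤ (E t).comap (LinearMap.mul k S x) := by
      conv_lhs => rw [hEdef]
      unfold restrictIdeal
      rw [mulS_le]
      intro a ha b hb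
      change x * (a * b) ∈ E t
      rw [← mul_assoc]
      exact mul_mem_mulS (hI _ _ ha) hb
    exact hle hy
  have hright : ∀ t x y, y ∈ E t → y * x ∈ E t := by
    intro t x y hy
    have hle : E t ≤ (E t).comap ((LinearMap.mul k S).flip x) := by
      conv_lhs => rw [hEdef]
      unfold restrictIdeal
      rw [mulS_le]
      rintro a ha _ ⟨b, hb, rfl⟩
      change a * β t b * x ∈ E t
      -- Writing `x = β t (β t⁻¹ x)` moves the product inside `β t`, where the right ideal property
      -- of `I` applies.
      rw [mul_assoc, ← hinv t x, ← hmul]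
      exact mul_mem_mulS ha (Submodule.mem_map_of_mem (hI' _ _ hb))
    exact hle hy
  have hrange : ∀ t, LinearMap.range ((restrict β hmul hinv I hI).act t) =
      (restrict β hmul hinv I hI).dom t := by
    intro t
    ext x
    constructor
    · rintro ⟨y, rfl⟩
      change β t y.1.1 ∈ E t
      rw [← hEmap]
      exact Submodule.mem_map_of_mem y.2
    · intro hx
      change x.1 ∈ E t at hx
      rw [← hEmap] at hx
      obtain ⟨y, hy, hyx⟩ := hx
      exact ⟨⟨⟨y, hEI _ hy⟩, hy⟩, Subtype.ext hyx⟩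
  refine ⟨?_, ?_, ?_, ?_, hrange, ?_, ?_, ?_, ?_, ?_, ?_⟩
  · exact fun t a d hd => hleft t a d hd
  · exact fun t a d hd => hright t a d hd
  · intro t x y z hz
    apply Subtype.ext
    change β t z.1.1 = β t x.1.1 * β t y.1.1
    rw [hz, ← hmul]
    rfl
  · intro t x y hxy
    have h : β t x.1.1 = β t y.1.1 := congrArg Subtype.val hxy
    apply Subtype.ext
    apply Subtype.ext
    have h2 := congrArg (β t⁻¹) h
    rwa [hβ, hβ, inv_mul_cancel, hone, hone] at h2
  · rw [eq_top_iff]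
    intro x _
    change x.1 ∈ E 1
    rw [hE, hidemJ, hJ1]
    exact x.2
  · intro x
    exact Subtype.ext (hone _)
  · intro t
    apply eq_of_map_incl_eq
    change ((E t).comap (incl I) ⋆ (E t).comap (incl I)).map (incl I) =
      ((E t).comap (incl I)).map (incl I)
    rw [map_incl_mulS_comap (hEI t) (hEI t), map_comap_incl (hEI t), hEE, hidemJ, hE]
  · intro s t
    apply eq_of_map_incl_eq
    change ((E s).comap (incl I) ⋆ (E t).comap (incl I)).map (incl I) =
      ((E t).comap (incl I) ⋆ (E s).comap (incl I)).map (incl I)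
    rw [map_incl_mulS_comap (hEI s) (hEI t), map_incl_mulS_comap (hEI t) (hEI s), hEE, hEE,
      hcommJ s t]
  · intro s t
    apply eq_of_map_incl_eq
    change _ = ((E s).comap (incl I) ⋆ (E (s * t)).comap (incl I)).map (incl I)
    rw [map_incl_mulS_comap (hEI s) (hEI _), hEE]
    -- `β s` sends the factors `J 1`, `J s⁻¹`, `J t` to `J s`, `J 1`, `J (s * t)`, so only the first
    -- two need to be interchanged.
    have key : J 1 ⋆ (J s ⋆ J (s * t)) = (E s⁻¹ ⋆ E t).map (β s) := by
      rw [hEE, hmap, hmap, hmapJ, hmapJ, hmapJ, mul_inv_cancel, mul_one, ← mulS_assoc, ← mulS_assoc,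
        hcommJ 1 s]
    rw [key, ← map_incl_mulS_comap (hEI s⁻¹) (hEI t)]
    ext x
    constructor
    · rintro ⟨_, ⟨y, hy, rfl⟩, rfl⟩
      exact ⟨y.1.1, ⟨y.1, hy, rfl⟩, rfl⟩
    · rintro ⟨_, ⟨y, hy, rfl⟩, rfl⟩
      have hyE : y ∈ (restrict β hmul hinv I hI).dom s⁻¹ := by
        have hle : (restrict β hmul hinv I hI).dom s⁻¹ ⋆ (E t).comap (incl I) ≤
            (restrict β hmul hinv I hI).dom s⁻¹ :=
          mulS_le.2 fun a ha b _ => hright _ _ _ ha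
        exact hle hy
      exact ⟨_, ⟨⟨y, hyE⟩, hy, rfl⟩, rfl⟩
  · intro s t x y z _ hy hz
    apply Subtype.ext
    change β s y.1.1 = β (s * t) z.1.1
    rw [hy, hz, ← hβ]
    rfl

end Restrict

/-! ### Transport of a product partial action along an algebra isomorphism. -/

section Transport

variable {k G A B : Type*} [CommRing k] [Group G]
  [NonUnitalRing A] [Module k A] [IsScalarTower k A A] [SMulCommClass k A A]
  [NonUnitalRing B] [Module k B] [IsScalarTower k B B] [SMulCommClass k B B]

/-- The partial action on `A` which corresponds to `β` under an isomorphism `e : A ≃ B`. -/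
def transport (e : A ≃ₗ[k] B) (β : PartialActionData k G B) : PartialActionData k G A where
  dom t := (β.dom t).comap e.toLinearMap
  act t := e.symm.toLinearMap ∘ₗ β.act t ∘ₗ
    (e.toLinearMap.restrict (p := (β.dom t⁻¹).comap e.toLinearMap) (q := β.dom t⁻¹) fun _ h => h)

theorem transport_isProductPartialAction (e : A ≃ₗ[k] B) (he : ∀ x y, e (x * y) = e x * e y)
    {β : PartialActionData k G B} (h : β.IsProductPartialAction) :
    (transport e β).IsProductPartialAction := by
  have hcomap : ∀ P Q : Submodule k B,
      P.comap e.toLinearMap ⋆ Q.comap e.toLinearMap = (P ⋆ Q).comap e.toLinearMap := by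
    intro P Q
    apply Submodule.map_injective_of_injective e.injective
    rw [map_mulS (f := e.toLinearMap) he]
    simp only [Submodule.map_comap_eq_of_surjective e.surjective]
  have hact : ∀ t (x : (transport e β).dom t⁻¹),
      e ((transport e β).act t x) = β.act t ⟨e x.1, x.2⟩ :=
    fun t x => e.apply_symm_apply _
  refine ⟨?_, ?_, ?_, ?_, ?_, ?_, ?_, ?_, ?_, ?_, ?_⟩
  · intro t a d hd
    change e (a * d) ∈ β.dom t
    rw [he]
    exact h.mul_mem_left _ _ _ hd
  · intro t a d hd
    change e (d * a) ∈ β.dom t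
    rw [he]
    exact h.mul_mem_right _ _ _ hd
  · intro t x y z hz
    apply e.injective
    rw [he, hact, hact, hact]
    apply h.act_mul
    change e z.1 = e x.1 * e y.1
    rw [hz, he]
  · intro t x y hxy
    have h1 := congrArg e hxy
    rw [hact, hact] at h1
    have h2 := congrArg Subtype.val (h.act_injective t h1)
    exact Subtype.ext (e.injective h2)
  · intro t
    ext x
    change _ ↔ e x ∈ β.dom t
    rw [← h.act_range]
    constructor
    · rintro ⟨y, rfl⟩
      exact ⟨_, (hact t y).symm⟩
    · rintro ⟨y, hy⟩
      have hy' : e.symm y.1 ∈ (transport e β).dom t⁻¹ := by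
        change e (e.symm y.1) ∈ β.dom t⁻¹
        rw [e.apply_symm_apply]
        exact y.2
      refine ⟨⟨e.symm y.1, hy'⟩, e.injective ?_⟩
      rw [hact, ← hy]
      congr 1
      exact Subtype.ext (e.apply_symm_apply _)
  · rw [eq_top_iff]
    intro x _
    change e x ∈ β.dom 1
    rw [h.dom_one]
    trivial
  · intro x
    apply e.injective
    rw [hact, h.act_one]
  · intro t
    change (β.dom t).comap e.toLinearMap ⋆ (β.dom t).comap e.toLinearMap = _
    rw [hcomap, h.dom_idem]
    rfl
  · intro s t
    change (β.dom s).comap e.toLinearMap ⋆ (β.dom t).comap e.toLinearMap =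
      (β.dom t).comap e.toLinearMap ⋆ (β.dom s).comap e.toLinearMap
    rw [hcomap, hcomap, h.dom_comm]
  · intro s t
    change (((β.dom s⁻¹).comap e.toLinearMap ⋆ (β.dom t).comap e.toLinearMap).comap
      ((transport e β).dom s⁻¹).subtype).map ((transport e β).act s) =
      (β.dom s).comap e.toLinearMap ⋆ (β.dom (s * t)).comap e.toLinearMap
    rw [hcomap, hcomap, ← h.act_dom]
    ext x
    constructor
    · rintro ⟨y, hy, rfl⟩
      exact ⟨_, hy, (hact s y).symm⟩
    · rintro ⟨y, hy, hyx⟩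
      have hy' : e.symm y.1 ∈ (transport e β).dom s⁻¹ := by
        change e (e.symm y.1) ∈ β.dom s⁻¹
        rw [e.apply_symm_apply]
        exact y.2
      refine ⟨⟨e.symm y.1, hy'⟩, ?_, e.injective ?_⟩
      · change e (e.symm y.1) ∈ β.dom s⁻¹ ⋆ β.dom t
        rw [e.apply_symm_apply]
        exact hy
      · rw [hact]
        refine Eq.trans ?_ hyx
        congr 1
        exact Subtype.ext (e.apply_symm_apply _)
  · intro s t x y z hx hy hz
    apply e.injective
    rw [hact, hact]
    refine h.act_act s t ⟨e x.1, x.2⟩ _ _ ?_ ?_ ?_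
    · change x.1 ∈ (β.dom t⁻¹).comap e.toLinearMap ⋆ (β.dom (s * t)⁻¹).comap e.toLinearMap at hx
      rwa [hcomap] at hx
    · change e y.1 = _
      rw [hy, hact]
    · change e z.1 = e x.1
      rw [hz]

end Transport

end PartialActionData

/-- The commutation of `I` with `β_t(I)` holds because the two products have the same family of
entries. -/
theorem Grading.IsPartiallyStrong.canonicalPartialAction_isProductPartialAction
    {k G B : Type*} [CommRing k] [Group G] [NonUnitalRing B] [Module k B]
    [IsScalarTower k B B] [SMulCommClass k B B] {ℬ : Grading k G B} (h : ℬ.IsPartiallyStrong) :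
    ℬ.canonicalPartialAction.IsProductPartialAction := by
  apply PartialActionData.restrict_isProductPartialAction
  · intro s t x
    ext p q
    simp only [dualAction_entry, mul_inv_rev, mul_assoc]
  · exact ℬ.partialSmash_mul_mem
  · exact h.partialSmash_idem
  · intro t
    rw [h.map_dualAction_mulS, ← h.restrictIdeal_eq]
    rfl

theorem IsDirectSum.prod {k G M N : Type*} [CommRing k] [AddCommGroup M] [Module k M]
    [AddCommGroup N] [Module k N] {V : G → Submodule k M} {W : G → Submodule k N}
    (hV : IsDirectSum V) (hW : IsDirectSum W) : IsDirectSum fun t => (V t).prod (W t) where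
  indep := by
    intro t
    rw [Submodule.disjoint_def]
    rintro ⟨v, w⟩ ⟨hv, hw⟩ h
    have hle : ⨆ j, ⨆ (_ : j ≠ t), (V j).prod (W j) ≤
        (⨆ j, ⨆ (_ : j ≠ t), V j).prod (⨆ j, ⨆ (_ : j ≠ t), W j) :=
      iSup₂_le fun j hj => Submodule.prod_mono (le_iSup₂_of_le j hj le_rfl)
        (le_iSup₂_of_le j hj le_rfl)
    have h' := hle h
    exact Prod.ext (Submodule.disjoint_def.1 (hV.indep t) v hv h'.1)
      (Submodule.disjoint_def.1 (hW.indep t) w hw h'.2)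
  iSup_eq := by
    rw [eq_top_iff]
    rintro ⟨v, w⟩ -
    have hv : v ∈ ⨆ t, V t := hV.iSup_eq ▸ Submodule.mem_top
    have hw : w ∈ ⨆ t, W t := hW.iSup_eq ▸ Submodule.mem_top
    have h1 : ⨆ t, V t ≤ (⨆ t, (V t).prod (W t)).comap (LinearMap.inl k M N) :=
      iSup_le fun t x hx => Submodule.mem_iSup_of_mem t
        (show (x, (0 : N)) ∈ (V t).prod (W t) from ⟨hx, zero_mem _⟩)
    have h2 : ⨆ t, W t ≤ (⨆ t, (V t).prod (W t)).comap (LinearMap.inr k M N) :=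
      iSup_le fun t x hx => Submodule.mem_iSup_of_mem t
        (show ((0 : M), x) ∈ (V t).prod (W t) from ⟨zero_mem _, hx⟩)
    have h : (v, (0 : N)) + ((0 : M), w) ∈ ⨆ t, (V t).prod (W t) := add_mem (h1 hv) (h2 hw)
    simpa using h

/-! ### Families of submodules indexed by matrix positions and degrees -/

/-- A family `P i j t` of submodules which multiplies like the homogeneous components of a graded
Morita context: the components of degree `1` are full and act unitally, and the diagonal ones are
partially strong. -/
structure IsMatrixRep {k G ι R : Type*} [CommRing k] [Group G] [NonUnitalRing R] [Module k R]
    [IsScalarTower k R R] [SMulCommClass k R R] (P : ι → ι → G → Submodule k R) : Prop where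
  mul_le : ∀ i j l s t, P i j s ⋆ P j l t ≤ P i l (s * t)
  mul_inv_mul : ∀ i t, P i i t ⋆ P i i t⁻¹ ⋆ P i i t = P i i t
  one_mul : ∀ i j t, P i i 1 ⋆ P i j t = P i j t
  mul_one : ∀ i j t, P i j t ⋆ P j j 1 = P i j t
  one_mul_one : ∀ i j, P i j 1 ⋆ P j i 1 = P i i 1

namespace IsMatrixRep

variable {k G ι R : Type*} [CommRing k] [Group G] [NonUnitalRing R] [Module k R]
    [IsScalarTower k R R] [SMulCommClass k R R] {P : ι → ι → G → Submodule k R}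
    (h : IsMatrixRep P)
include h

theorem mul_le_of_eq {i j l : ι} {s t u : G} (e : s * t = u) : P i j s ⋆ P j l t ≤ P i l u :=
  e ▸ h.mul_le i j l s t

/-- The degree `1` pieces change the row index without loss, since `P i i 1` factors as `P i j 1 ⋆ P
j i 1`. -/
theorem one_mul' (i j l : ι) (t : G) : P i j 1 ⋆ P j l t = P i l t := by
  apply le_antisymm (h.mul_le_of_eq (_root_.one_mul t))
  conv_lhs => rw [← h.one_mul i l, ← h.one_mul_one i j, mulS_assoc]
  exact mulS_mono le_rfl (h.mul_le_of_eq (_root_.one_mul t))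

theorem mul_one' (i j l : ι) (t : G) : P i j t ⋆ P j l 1 = P i l t := by
  apply le_antisymm (h.mul_le_of_eq (_root_.mul_one t))
  conv_lhs => rw [← h.mul_one i l, ← h.one_mul_one l j, ← mulS_assoc]
  exact mulS_mono (h.mul_le_of_eq (_root_.mul_one t)) le_rfl

/-- The middle index is immaterial: insert `P j i 1` in front of `P i l t`, then absorb it into `P i
j s`. For a Morita context this contains `X_s Y_t = A_s A_t`. -/
theorem mul_eq (i j l : ι) (s t : G) : P i j s ⋆ P j l t = P i i s ⋆ P i l t := by
  rw [← h.one_mul' i j l t, ← mulS_assoc, h.mul_one']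

/-- Partial strongness passes from the diagonal to the other positions through `P i j t = P i i t ⋆
P i j 1`. -/
theorem le_mul_inv_mul (i j : ι) (t : G) : P i j t ≤ P i i t ⋆ P i i t⁻¹ ⋆ P i j t := by
  conv_lhs => rw [← h.mul_one' i i j, ← h.mul_inv_mul i t, mulS_assoc]
  exact mulS_mono le_rfl (h.mul_le_of_eq (_root_.mul_one t))

end IsMatrixRep

/-! ### The context algebra and its four corners. -/

namespace MoritaContext

variable {k G A B X Y : Type*} [CommRing k] [Group G]
  [NonUnitalRing A] [Module k A] [NonUnitalRing B] [Module k B]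
  [AddCommGroup X] [Module k X] [AddCommGroup Y] [Module k Y]

section Blocks

variable (M : MoritaContext k A B X Y)

/-- `X` as the upper right corner of the context algebra. -/
def inX : X →ₗ[k] M.ContextAlg where
  toFun x := ContextAlg.mk 0 x 0 0
  map_add' _ _ := by ext <;> simp
  map_smul' _ _ := by ext <;> simp

/-- `Y` as the lower left corner of the context algebra. -/
def inY : Y →ₗ[k] M.ContextAlg where
  toFun y := ContextAlg.mk 0 0 y 0
  map_add' _ _ := by ext <;> simp
  map_smul' _ _ := by ext <;> simp

/-- The upper left entry, as a linear map. -/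
def projA : M.ContextAlg →ₗ[k] A := ⟨⟨ContextAlg.a, fun _ _ => rfl⟩, fun _ _ => rfl⟩
/-- The upper right entry, as a linear map. -/
def projX : M.ContextAlg →ₗ[k] X := ⟨⟨ContextAlg.x, fun _ _ => rfl⟩, fun _ _ => rfl⟩
/-- The lower left entry, as a linear map. -/
def projY : M.ContextAlg →ₗ[k] Y := ⟨⟨ContextAlg.y, fun _ _ => rfl⟩, fun _ _ => rfl⟩
/-- The lower right entry, as a linear map. -/
def projB : M.ContextAlg →ₗ[k] B := ⟨⟨ContextAlg.b, fun _ _ => rfl⟩, fun _ _ => rfl⟩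

theorem inA_apply (a : A) : M.inA a = ContextAlg.mk a 0 0 0 := rfl
theorem inX_apply (x : X) : M.inX x = ContextAlg.mk 0 x 0 0 := rfl
theorem inY_apply (y : Y) : M.inY y = ContextAlg.mk 0 0 y 0 := rfl
theorem inB_apply (b : B) : M.inB b = ContextAlg.mk 0 0 0 b := rfl

theorem projA_apply (c : M.ContextAlg) : M.projA c = c.a := rfl
theorem projX_apply (c : M.ContextAlg) : M.projX c = c.x := rfl
theorem projY_apply (c : M.ContextAlg) : M.projY c = c.y := rfl
theorem projB_apply (c : M.ContextAlg) : M.projB c = c.b := rfl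

theorem projA_inA (a : A) : M.projA (M.inA a) = a := rfl
theorem projX_inX (x : X) : M.projX (M.inX x) = x := rfl
theorem projY_inY (y : Y) : M.projY (M.inY y) = y := rfl
theorem projB_inB (b : B) : M.projB (M.inB b) = b := rfl

theorem inA_mul (a a' : A) : M.inA (a * a') = M.inA a * M.inA a' := by
  ext <;> simp [inA_apply]
theorem inA_τA (x : X) (y : Y) : M.inA (M.τA x y) = M.inX x * M.inY y := by
  ext <;> simp [inA_apply, inX_apply, inY_apply]
theorem inX_AX (a : A) (x : X) : M.inX (M.AX a x) = M.inA a * M.inX x := by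
  ext <;> simp [inA_apply, inX_apply]
theorem inX_XB (x : X) (b : B) : M.inX (M.XB x b) = M.inX x * M.inB b := by
  ext <;> simp [inB_apply, inX_apply]
theorem inY_YA (y : Y) (a : A) : M.inY (M.YA y a) = M.inY y * M.inA a := by
  ext <;> simp [inA_apply, inY_apply]
theorem inY_BY (b : B) (y : Y) : M.inY (M.BY b y) = M.inB b * M.inY y := by
  ext <;> simp [inB_apply, inY_apply]
theorem inB_τB (y : Y) (x : X) : M.inB (M.τB y x) = M.inY y * M.inX x := by
  ext <;> simp [inB_apply, inX_apply, inY_apply]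
theorem inB_mul (b b' : B) : M.inB (b * b') = M.inB b * M.inB b' := by
  ext <;> simp [inB_apply]

/-- The homogeneous components of the four corners, as submodules of the context algebra; the row
and column of `A` have index `false`, those of `B` have index `true`. -/
def block (𝒜 : Grading k G A) (ℬ : Grading k G B) (𝒳 : G → Submodule k X)
    (𝒴 : G → Submodule k Y) : Bool → Bool → G → Submodule k M.ContextAlg
  | false, false, t => (𝒜.comp t).map M.inA
  | false, true, t => (𝒳 t).map M.inX
  | true, false, t => (𝒴 t).map M.inY
  | true, true, t => (ℬ.comp t).map M.inB

/-- The projections of the context algebra onto its four corners. -/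
def corner : Bool → Bool → M.ContextAlg →ₗ[k] M.ContextAlg
  | false, false => M.inA ∘ₗ M.projA
  | false, true => M.inX ∘ₗ M.projX
  | true, false => M.inY ∘ₗ M.projY
  | true, true => M.inB ∘ₗ M.projB

theorem sum_corner (c : M.ContextAlg) : ∑ i, ∑ j, M.corner i j c = c := by
  simp only [Fintype.sum_bool]
  ext <;> simp [corner, inA_apply, inB_apply, inX_apply, inY_apply, projA_apply, projB_apply,
      projX_apply, projY_apply]

theorem corner_mul (i l : Bool) (c d : M.ContextAlg) :
    M.corner i l (c * d) = ∑ j, M.corner i j c * M.corner j l d := by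
  cases i <;> cases l <;> simp only [Fintype.sum_bool] <;> ext <;>
    simp [corner, inA_apply, inB_apply, inX_apply, inY_apply, projA_apply, projB_apply,
      projX_apply, projY_apply, add_comm]

/-- The elements of the context algebra with corners in prescribed submodules. -/
def cornersIn (W : Bool → Bool → Submodule k M.ContextAlg) : Submodule k M.ContextAlg where
  carrier := {c | ∀ i j, M.corner i j c ∈ W i j}
  add_mem' hc hd i j := by
    rw [map_add]
    exact add_mem (hc i j) (hd i j)
  zero_mem' i j := by
    rw [map_zero]
    exact zero_mem _
  smul_mem' l c hc i j := by
    rw [map_smul]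
    exact Submodule.smul_mem _ l (hc i j)

variable {M}

theorem cornersIn_le {W : Bool → Bool → Submodule k M.ContextAlg} {N : Submodule k M.ContextAlg}
    (h : ∀ i j, W i j ≤ N) : M.cornersIn W ≤ N := by
  intro c hc
  rw [← M.sum_corner c]
  exact N.sum_mem fun i _ => N.sum_mem fun j _ => h i j (hc i j)

theorem mulS_cornersIn_le [IsScalarTower k A A] [SMulCommClass k A A]
    [IsScalarTower k B B] [SMulCommClass k B B]
    {U V W : Bool → Bool → Submodule k M.ContextAlg}
    (h : ∀ i j l, V i j ⋆ W j l ≤ U i l) : M.cornersIn V ⋆ M.cornersIn W ≤ M.cornersIn U := by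
  rw [mulS_le]
  intro c hc d hd i l
  rw [corner_mul]
  exact Submodule.sum_mem _ fun j _ => h i j l (mul_mem_mulS (hc i j) (hd j l))

end Blocks

/-! ### The grading of the context algebra and its partial strongness. -/

section Graded

variable {M : MoritaContext k A B X Y} {𝒜 : Grading k G A} {ℬ : Grading k G B}
  {𝒳 : G → Submodule k X} {𝒴 : G → Submodule k Y}

theorem block_le_cornersIn (i j : Bool) (t : G) :
    M.block 𝒜 ℬ 𝒳 𝒴 i j t ≤ M.cornersIn fun i j => M.block 𝒜 ℬ 𝒳 𝒴 i j t := by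
  cases i <;> cases j <;> rintro _ ⟨z, hz, rfl⟩ i' j' <;> cases i' <;> cases j' <;>
    first
    | exact ⟨z, hz, rfl⟩
    | exact ⟨0, zero_mem _, rfl⟩

theorem IsGraded.mul_mem_block (h : M.IsGraded 𝒜 ℬ 𝒳 𝒴) {i j l : Bool} {s t : G}
    {c d : M.ContextAlg} (hc : c ∈ M.block 𝒜 ℬ 𝒳 𝒴 i j s) (hd : d ∈ M.block 𝒜 ℬ 𝒳 𝒴 j l t) :
    c * d ∈ M.block 𝒜 ℬ 𝒳 𝒴 i l (s * t) := by
  cases i <;> cases j <;> cases l <;> obtain ⟨u, hu, rfl⟩ := hc <;> obtain ⟨v, hv, rfl⟩ := hd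
  · exact ⟨_, 𝒜.mul_mem hu hv, M.inA_mul u v⟩
  · exact ⟨_, h.AX_mem hu hv, M.inX_AX u v⟩
  · exact ⟨_, h.τA_mem hu hv, M.inA_τA u v⟩
  · exact ⟨_, h.XB_mem hu hv, M.inX_XB u v⟩
  · exact ⟨_, h.YA_mem hu hv, M.inY_YA u v⟩
  · exact ⟨_, h.τB_mem hu hv, M.inB_τB u v⟩
  · exact ⟨_, h.BY_mem hu hv, M.inY_BY u v⟩
  · exact ⟨_, ℬ.mul_mem hu hv, M.inB_mul u v⟩

/-- The grading of the context algebra of a graded Morita context. -/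
def IsGraded.grading (h : M.IsGraded 𝒜 ℬ 𝒳 𝒴) : Grading k G M.ContextAlg where
  comp t := M.cornersIn fun i j => M.block 𝒜 ℬ 𝒳 𝒴 i j t
  isDirectSum := by
    -- In coordinates the component of degree `t` is a product of four submodules, and direct sum
    -- decompositions pass to products.
    have e : (fun t => M.cornersIn fun i j => M.block 𝒜 ℬ 𝒳 𝒴 i j t) = fun t =>
        (show Submodule k M.ContextAlg from
          (𝒜.comp t).prod ((𝒳 t).prod ((𝒴 t).prod (ℬ.comp t)))) := by
      funext t
      ext c
      constructor
      · intro hc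
        obtain ⟨a, ha, hca⟩ := hc false false
        obtain ⟨x, hx, hcx⟩ := hc false true
        obtain ⟨y, hy, hcy⟩ := hc true false
        obtain ⟨b, hb, hcb⟩ := hc true true
        have hca : a = c.a := congrArg M.projA hca
        have hcx : x = c.x := congrArg M.projX hcx
        have hcy : y = c.y := congrArg M.projY hcy
        have hcb : b = c.b := congrArg M.projB hcb
        subst hca hcx hcy hcb
        exact ⟨ha, hx, hy, hb⟩
      · rintro ⟨ha, hx, hy, hb⟩ i j
        cases i <;> cases j
        exacts [⟨_, ha, rfl⟩, ⟨_, hx, rfl⟩, ⟨_, hy, rfl⟩, ⟨_, hb, rfl⟩]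
    rw [e]
    exact 𝒜.isDirectSum.prod (h.isDirectSum_X.prod (h.isDirectSum_Y.prod ℬ.isDirectSum))
  mul_mem := by
    intro s t c d hc hd i l
    rw [corner_mul]
    refine Submodule.sum_mem _ fun j _ => ?_
    exact h.mul_mem_block (hc i j) (hd j l)

theorem IsGraded.block_le (h : M.IsGraded 𝒜 ℬ 𝒳 𝒴) (i j : Bool) (t : G) :
    M.block 𝒜 ℬ 𝒳 𝒴 i j t ≤ h.grading.comp t :=
  block_le_cornersIn i j t

variable [IsScalarTower k A A] [SMulCommClass k A A] [IsScalarTower k B B] [SMulCommClass k B B]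

theorem map_inA_mulS (P Q : Submodule k A) : (P ⋆ Q).map M.inA = P.map M.inA ⋆ Q.map M.inA :=
  map_mulS M.inA_mul P Q

theorem map_inB_mulS (P Q : Submodule k B) : (P ⋆ Q).map M.inB = P.map M.inB ⋆ Q.map M.inB :=
  map_mulS M.inB_mul P Q

theorem IsGraded.block_mul_le (h : M.IsGraded 𝒜 ℬ 𝒳 𝒴) (i j l : Bool) (s t : G) :
    M.block 𝒜 ℬ 𝒳 𝒴 i j s ⋆ M.block 𝒜 ℬ 𝒳 𝒴 j l t ≤ M.block 𝒜 ℬ 𝒳 𝒴 i l (s * t) :=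
  mulS_le.2 fun _ hc _ hd => h.mul_mem_block hc hd

/-- The strong conditions enter here. Since `D_t` lies in degree `1`, unitality of `X_t` and `Y_t`
over these ideals makes the degree `1` components act as identities. The trace condition at `t = 1`
gives `X_1 Y_1 = D_1^A = A_1 A_1 = A_1`, and likewise for `B`. -/
theorem IsStrongGradedEquivalence.isMatrixRep (hM : M.IsStrongGradedEquivalence 𝒜 ℬ 𝒳 𝒴)
    (h𝒜 : 𝒜.IsPartiallyStrong) (hℬ : ℬ.IsPartiallyStrong) :
    IsMatrixRep (M.block 𝒜 ℬ 𝒳 𝒴) := by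
  have hA := h𝒜.isPartialRep
  have hB := hℬ.isPartialRep
  have hle := hM.isGraded.block_mul_le
  have hDA : ∀ t, 𝒜.D t ≤ 𝒜.comp 1 := fun t => 𝒜.mulS_comp_le (mul_inv_cancel t)
  have hDB : ∀ t, ℬ.D t ≤ ℬ.comp 1 := fun t => ℬ.mulS_comp_le (mul_inv_cancel t)
  refine ⟨hle, ?_, ?_, ?_, ?_⟩
  · rintro (_ | _) t
    · change (𝒜.comp t).map M.inA ⋆ (𝒜.comp t⁻¹).map M.inA ⋆ (𝒜.comp t).map M.inA =
        (𝒜.comp t).map M.inA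
      rw [← map_inA_mulS, ← map_inA_mulS, h𝒜]
    · change (ℬ.comp t).map M.inB ⋆ (ℬ.comp t⁻¹).map M.inB ⋆ (ℬ.comp t).map M.inB =
        (ℬ.comp t).map M.inB
      rw [← map_inB_mulS, ← map_inB_mulS, hℬ]
  · intro i j t
    refine le_antisymm ((hle i i j 1 t).trans_eq (by rw [one_mul])) ?_
    rcases i with _ | _ <;> rcases j with _ | _
    · change (𝒜.comp t).map M.inA ≤ (𝒜.comp 1).map M.inA ⋆ (𝒜.comp t).map M.inA
      rw [← map_inA_mulS, hA.one_mul]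
    · change (𝒳 t).map M.inX ≤ (𝒜.comp 1).map M.inA ⋆ (𝒳 t).map M.inX
      conv_lhs => rw [← hM.DA_X t]
      rw [map_map₂_eq_mulS M.inX_AX]
      exact mulS_mono (Submodule.map_mono (hDA t)) le_rfl
    · change (𝒴 t).map M.inY ≤ (ℬ.comp 1).map M.inB ⋆ (𝒴 t).map M.inY
      conv_lhs => rw [← hM.DB_Y t]
      rw [map_map₂_eq_mulS M.inY_BY]
      exact mulS_mono (Submodule.map_mono (hDB t)) le_rfl
    · change (ℬ.comp t).map M.inB ≤ (ℬ.comp 1).map M.inB ⋆ (ℬ.comp t).map M.inB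
      rw [← map_inB_mulS, hB.one_mul]
  · intro i j t
    refine le_antisymm ((hle i j j t 1).trans_eq (by rw [mul_one])) ?_
    rcases i with _ | _ <;> rcases j with _ | _
    · change (𝒜.comp t).map M.inA ≤ (𝒜.comp t).map M.inA ⋆ (𝒜.comp 1).map M.inA
      rw [← map_inA_mulS, hA.mul_one]
    · change (𝒳 t).map M.inX ≤ (𝒳 t).map M.inX ⋆ (ℬ.comp 1).map M.inB
      conv_lhs => rw [← hM.X_DB t]
      rw [map_map₂_eq_mulS M.inX_XB]
      exact mulS_mono le_rfl (Submodule.map_mono (hDB _))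
    · change (𝒴 t).map M.inY ≤ (𝒴 t).map M.inY ⋆ (𝒜.comp 1).map M.inA
      conv_lhs => rw [← hM.Y_DA t]
      rw [map_map₂_eq_mulS M.inY_YA]
      exact mulS_mono le_rfl (Submodule.map_mono (hDA _))
    · change (ℬ.comp t).map M.inB ≤ (ℬ.comp t).map M.inB ⋆ (ℬ.comp 1).map M.inB
      rw [← map_inB_mulS, hB.mul_one]
  · rintro (_ | _) (_ | _)
    · change (𝒜.comp 1).map M.inA ⋆ (𝒜.comp 1).map M.inA = (𝒜.comp 1).map M.inA
      rw [← map_inA_mulS, hA.one_mul]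
    · change (𝒳 1).map M.inX ⋆ (𝒴 1).map M.inY = (𝒜.comp 1).map M.inA
      have h := hM.τA_eq 1
      rw [Grading.D, inv_one, hA.one_mul] at h
      rw [← map_map₂_eq_mulS M.inA_τA, h]
    · change (𝒴 1).map M.inY ⋆ (𝒳 1).map M.inX = (ℬ.comp 1).map M.inB
      have h := hM.τB_eq 1
      rw [Grading.D, inv_one, hB.one_mul] at h
      rw [← map_map₂_eq_mulS M.inB_τB, h]
    · change (ℬ.comp 1).map M.inB ⋆ (ℬ.comp 1).map M.inB = (ℬ.comp 1).map M.inB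
      rw [← map_inB_mulS, hB.one_mul]

/-- Each corner of `C_t` is recovered by multiplying it with the diagonal corners of `C_t` and
`C_{t⁻¹}`, by `le_mul_inv_mul`. -/
theorem IsGraded.grading_isPartiallyStrong (h : M.IsGraded 𝒜 ℬ 𝒳 𝒴)
    (hP : IsMatrixRep (M.block 𝒜 ℬ 𝒳 𝒴)) : h.grading.IsPartiallyStrong := by
  intro t
  apply le_antisymm
  · refine (mulS_mono (h.grading.mulS_comp_le rfl) le_rfl).trans
      (h.grading.mulS_comp_le ?_)
    group
  · exact cornersIn_le fun i j => (hP.le_mul_inv_mul i j t).trans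
      (mulS_mono (mulS_mono (h.block_le _ _ _) (h.block_le _ _ _)) (h.block_le _ _ _))

/-- A corner of `C_s C_t` is a sum over the middle index, and by `mul_eq` both summands are the same
submodule. This is what keeps the diagonal corners of `I^C` from exceeding `I^A` and `I^B`. The
version with four factors serves the domains of `γ^C`. -/
theorem IsGraded.mulS_comp_le_cornersIn (h : M.IsGraded 𝒜 ℬ 𝒳 𝒴)
    (hP : IsMatrixRep (M.block 𝒜 ℬ 𝒳 𝒴)) (s t : G) :
    h.grading.comp s ⋆ h.grading.comp t ≤
      M.cornersIn fun i j => M.block 𝒜 ℬ 𝒳 𝒴 i i s ⋆ M.block 𝒜 ℬ 𝒳 𝒴 i j t :=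
  mulS_cornersIn_le fun i j l => (hP.mul_eq i j l s t).le

theorem IsGraded.mulS_comp₄_le_cornersIn (h : M.IsGraded 𝒜 ℬ 𝒳 𝒴)
    (hP : IsMatrixRep (M.block 𝒜 ℬ 𝒳 𝒴)) (s t u v : G) :
    h.grading.comp s ⋆ (h.grading.comp t ⋆ (h.grading.comp u ⋆ h.grading.comp v)) ≤
      M.cornersIn fun i j => M.block 𝒜 ℬ 𝒳 𝒴 i i s ⋆
        (M.block 𝒜 ℬ 𝒳 𝒴 i i t ⋆ (M.block 𝒜 ℬ 𝒳 𝒴 i i u ⋆ M.block 𝒜 ℬ 𝒳 𝒴 i j v)) := by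
  refine (mulS_mono le_rfl (mulS_mono le_rfl (h.mulS_comp_le_cornersIn hP u v))).trans ?_
  refine (mulS_mono (Q' := M.cornersIn fun i j => M.block 𝒜 ℬ 𝒳 𝒴 i i t ⋆
    (M.block 𝒜 ℬ 𝒳 𝒴 i i u ⋆ M.block 𝒜 ℬ 𝒳 𝒴 i j v)) le_rfl
    (mulS_cornersIn_le fun i j l => ?_)).trans (mulS_cornersIn_le fun i j l => ?_)
  · rw [← mulS_assoc, hP.mul_eq i j j, mulS_assoc, hP.mul_eq i j l]
  · rw [← mulS_assoc, hP.mul_eq i j j, mulS_assoc, ← mulS_assoc (M.block 𝒜 ℬ 𝒳 𝒴 i j t),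
      hP.mul_eq i j j, mulS_assoc, hP.mul_eq i j l]

end Graded

end MoritaContext

/-! ### Morita contexts from corner decompositions -/

/-- A decomposition of an algebra `R` into four corners `A`, `X`, `Y`, `B` which multiply like the
entries of `2 × 2`-matrices. -/
structure CornerDecomposition (k A B X Y R : Type*) [CommRing k]
    [NonUnitalRing A] [Module k A] [NonUnitalRing B] [Module k B]
    [AddCommGroup X] [Module k X] [AddCommGroup Y] [Module k Y]
    [NonUnitalRing R] [Module k R] where
  inA : A →ₗ[k] R
  inX : X →ₗ[k] R
  inY : Y →ₗ[k] R
  inB : B →ₗ[k] R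
  projA : R →ₗ[k] A
  projX : R →ₗ[k] X
  projY : R →ₗ[k] Y
  projB : R →ₗ[k] B
  proj_sum : ∀ a x y b, projA (inA a + inX x + inY y + inB b) = a ∧
    projX (inA a + inX x + inY y + inB b) = x ∧ projY (inA a + inX x + inY y + inB b) = y ∧
    projB (inA a + inX x + inY y + inB b) = b
  sum_proj : ∀ r, inA (projA r) + inX (projX r) + inY (projY r) + inB (projB r) = r
  inA_mul : ∀ a a', inA (a * a') = inA a * inA a'
  inB_mul : ∀ b b', inB (b * b') = inB b * inB b'
  AX : ∀ a x, inX (projX (inA a * inX x)) = inA a * inX x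
  XB : ∀ x b, inX (projX (inX x * inB b)) = inX x * inB b
  BY : ∀ b y, inY (projY (inB b * inY y)) = inB b * inY y
  YA : ∀ y a, inY (projY (inY y * inA a)) = inY y * inA a
  XY : ∀ x y, inA (projA (inX x * inY y)) = inX x * inY y
  YX : ∀ y x, inB (projB (inY y * inX x)) = inY y * inX x
  AY : ∀ a y, inA a * inY y = 0
  AB : ∀ a b, inA a * inB b = 0
  XA : ∀ x a, inX x * inA a = 0
  XX : ∀ x x', inX x * inX x' = 0
  YY : ∀ y y', inY y * inY y' = 0
  YB : ∀ y b, inY y * inB b = 0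
  BA : ∀ b a, inB b * inA a = 0
  BX : ∀ b x, inB b * inX x = 0

namespace CornerDecomposition

variable {k A B X Y R : Type*} [CommRing k]
    [NonUnitalRing A] [Module k A] [NonUnitalRing B] [Module k B]
    [AddCommGroup X] [Module k X] [AddCommGroup Y] [Module k Y]
    [NonUnitalRing R] [Module k R] (P : CornerDecomposition k A B X Y R)

theorem projA_inA (a : A) : P.projA (P.inA a) = a := by simpa using (P.proj_sum a 0 0 0).1
theorem projX_inX (x : X) : P.projX (P.inX x) = x := by simpa using (P.proj_sum 0 x 0 0).2.1
theorem projY_inY (y : Y) : P.projY (P.inY y) = y := by simpa using (P.proj_sum 0 0 y 0).2.2.1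
theorem projB_inB (b : B) : P.projB (P.inB b) = b := by simpa using (P.proj_sum 0 0 0 b).2.2.2

theorem inA_injective : Function.Injective P.inA := Function.LeftInverse.injective P.projA_inA
theorem inX_injective : Function.Injective P.inX := Function.LeftInverse.injective P.projX_inX
theorem inY_injective : Function.Injective P.inY := Function.LeftInverse.injective P.projY_inY
theorem inB_injective : Function.Injective P.inB := Function.LeftInverse.injective P.projB_inB

variable [IsScalarTower k R R] [SMulCommClass k R R]

/-- The Morita context formed by the corners of `R`. -/
def context : MoritaContext k A B X Y where
  AX := ((LinearMap.mul k R).compl₁₂ P.inA P.inX).compr₂ P.projX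
  XB := ((LinearMap.mul k R).compl₁₂ P.inX P.inB).compr₂ P.projX
  BY := ((LinearMap.mul k R).compl₁₂ P.inB P.inY).compr₂ P.projY
  YA := ((LinearMap.mul k R).compl₁₂ P.inY P.inA).compr₂ P.projY
  τA := ((LinearMap.mul k R).compl₁₂ P.inX P.inY).compr₂ P.projA
  τB := ((LinearMap.mul k R).compl₁₂ P.inY P.inX).compr₂ P.projB
  -- Every axiom is checked after the injective inclusion of a corner into `R`, where it becomes
  -- associativity of `R`.
  mul_AX _ _ _ := P.inX_injective (by simp [P.AX, P.inA_mul, mul_assoc])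
  XB_mul _ _ _ := P.inX_injective (by simp [P.XB, P.inB_mul, mul_assoc])
  AX_XB _ _ _ := P.inX_injective (by simp [P.AX, P.XB, mul_assoc])
  mul_BY _ _ _ := P.inY_injective (by simp [P.BY, P.inB_mul, mul_assoc])
  YA_mul _ _ _ := P.inY_injective (by simp [P.YA, P.inA_mul, mul_assoc])
  BY_YA _ _ _ := P.inY_injective (by simp [P.BY, P.YA, mul_assoc])
  τA_balanced _ _ _ := P.inA_injective (by simp [P.XB, P.BY, mul_assoc])
  τA_left _ _ _ := P.inA_injective <| by
    simp only [LinearMap.compr₂_apply, LinearMap.compl₁₂_apply, LinearMap.mul_apply']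
    rw [P.XY, P.AX, P.inA_mul, P.XY, mul_assoc]
  τA_right _ _ _ := P.inA_injective <| by
    simp only [LinearMap.compr₂_apply, LinearMap.compl₁₂_apply, LinearMap.mul_apply']
    rw [P.XY, P.YA, P.inA_mul, P.XY, mul_assoc]
  τB_balanced _ _ _ := P.inB_injective (by simp [P.YA, P.AX, mul_assoc])
  τB_left _ _ _ := P.inB_injective <| by
    simp only [LinearMap.compr₂_apply, LinearMap.compl₁₂_apply, LinearMap.mul_apply']
    rw [P.YX, P.BY, P.inB_mul, P.YX, mul_assoc]
  τB_right _ _ _ := P.inB_injective <| by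
    simp only [LinearMap.compr₂_apply, LinearMap.compl₁₂_apply, LinearMap.mul_apply']
    rw [P.YX, P.XB, P.inB_mul, P.YX, mul_assoc]
  assoc_X _ _ _ := P.inX_injective (by simp [P.XY, P.YX, mul_assoc])
  assoc_Y _ _ _ := P.inY_injective (by simp [P.XY, P.YX, mul_assoc])

theorem inX_context_AX (a : A) (x : X) : P.inX (P.context.AX a x) = P.inA a * P.inX x := P.AX a x
theorem inX_context_XB (x : X) (b : B) : P.inX (P.context.XB x b) = P.inX x * P.inB b := P.XB x b
theorem inY_context_BY (b : B) (y : Y) : P.inY (P.context.BY b y) = P.inB b * P.inY y := P.BY b y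
theorem inY_context_YA (y : Y) (a : A) : P.inY (P.context.YA y a) = P.inY y * P.inA a := P.YA y a
theorem inA_context_τA (x : X) (y : Y) : P.inA (P.context.τA x y) = P.inX x * P.inY y := P.XY x y
theorem inB_context_τB (y : Y) (x : X) : P.inB (P.context.τB y x) = P.inY y * P.inX x := P.YX y x

open MoritaContext

/-- The context algebra of the Morita context formed by the corners of `R` is `R`. -/
def equiv : P.context.ContextAlg ≃ₗ[k] R where
  toFun c := P.inA c.a + P.inX c.x + P.inY c.y + P.inB c.b
  invFun r := ContextAlg.mk (P.projA r) (P.projX r) (P.projY r) (P.projB r)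
  map_add' c d := by
    simp only [ContextAlg.add_a, ContextAlg.add_x, ContextAlg.add_y, ContextAlg.add_b, map_add]
    abel
  map_smul' l c := by
    simp only [ContextAlg.smul_a, ContextAlg.smul_x, ContextAlg.smul_y, ContextAlg.smul_b,
      map_smul, smul_add, RingHom.id_apply]
  left_inv c := by
    obtain ⟨ha, hx, hy, hb⟩ := P.proj_sum c.a c.x c.y c.b
    exact ContextAlg.ext ha hx hy hb
  right_inv r := P.sum_proj r

theorem equiv_apply (c : P.context.ContextAlg) :
    P.equiv c = P.inA c.a + P.inX c.x + P.inY c.y + P.inB c.b := rfl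

/-- Of the sixteen products of corners in `R`, eight vanish and the other eight are those of the
matrix product. -/
theorem equiv_mul (c d : P.context.ContextAlg) : P.equiv (c * d) = P.equiv c * P.equiv d := by
  simp only [equiv_apply, ContextAlg.mul_a, ContextAlg.mul_x, ContextAlg.mul_y, ContextAlg.mul_b,
    map_add, P.inX_context_AX, P.inX_context_XB, P.inY_context_BY, P.inY_context_YA,
    P.inA_context_τA, P.inB_context_τB, P.inA_mul, P.inB_mul, mul_add, add_mul, P.AY, P.AB, P.XA,
    P.XX, P.YY, P.YB, P.BA, P.BX]
  abel

theorem equiv_inA (a : A) : P.equiv (P.context.inA a) = P.inA a := by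
  simp [equiv_apply, inA_apply]

theorem equiv_inB (b : B) : P.equiv (P.context.inB b) = P.inB b := by
  simp [equiv_apply, inB_apply]

section Unital

variable {S : Type*} [NonUnitalRing S] [Module k S] [IsScalarTower k S S] [SMulCommClass k S S]
  {j : R →ₗ[k] S} (hj : Function.Injective j) (hmul : ∀ r r', j (r * r') = j r * j r')
  {E : Bool → Bool → Submodule k S}
  (hA : (⊤ : Submodule k A).map (j ∘ₗ P.inA) = E false false)
  (hX : (⊤ : Submodule k X).map (j ∘ₗ P.inX) = E false true)
  (hY : (⊤ : Submodule k Y).map (j ∘ₗ P.inY) = E true false)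
  (hB : (⊤ : Submodule k B).map (j ∘ₗ P.inB) = E true true)
include hj hmul hX hY

-- All six conditions take the form `E i l ⋆ E l m = E i m` once pushed forward along `j`. The
-- ambient algebra `S` stands for the smash product `C # G`, in which products of families of
-- entries can be computed.
include hA hB in
theorem context_isMoritaEquivalence (hE : ∀ i l m, E i l ⋆ E l m = E i m) :
    P.context.IsMoritaEquivalence where
  AX_unital := by
    apply Submodule.map_injective_of_injective (f := j ∘ₗ P.inX) (hj.comp P.inX_injective)
    rw [map_map₂_eq_mulS (f₁ := j ∘ₗ P.inA) (f₂ := j ∘ₗ P.inX) fun a x =>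
      (congrArg j (P.inX_context_AX a x)).trans (hmul (P.inA a) (P.inX x))]
    exact (congrArg₂ mulS hA hX).trans ((hE _ _ _).trans hX.symm)
  XB_unital := by
    apply Submodule.map_injective_of_injective (f := j ∘ₗ P.inX) (hj.comp P.inX_injective)
    rw [map_map₂_eq_mulS (f₁ := j ∘ₗ P.inX) (f₂ := j ∘ₗ P.inB) fun x b =>
      (congrArg j (P.inX_context_XB x b)).trans (hmul (P.inX x) (P.inB b))]
    exact (congrArg₂ mulS hX hB).trans ((hE _ _ _).trans hX.symm)
  BY_unital := by
    apply Submodule.map_injective_of_injective (f := j ∘ₗ P.inY) (hj.comp P.inY_injective)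
    rw [map_map₂_eq_mulS (f₁ := j ∘ₗ P.inB) (f₂ := j ∘ₗ P.inY) fun b y =>
      (congrArg j (P.inY_context_BY b y)).trans (hmul (P.inB b) (P.inY y))]
    exact (congrArg₂ mulS hB hY).trans ((hE _ _ _).trans hY.symm)
  YA_unital := by
    apply Submodule.map_injective_of_injective (f := j ∘ₗ P.inY) (hj.comp P.inY_injective)
    rw [map_map₂_eq_mulS (f₁ := j ∘ₗ P.inY) (f₂ := j ∘ₗ P.inA) fun y a =>
      (congrArg j (P.inY_context_YA y a)).trans (hmul (P.inY y) (P.inA a))]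
    exact (congrArg₂ mulS hY hA).trans ((hE _ _ _).trans hY.symm)
  τA_surj := by
    apply Submodule.map_injective_of_injective (f := j ∘ₗ P.inA) (hj.comp P.inA_injective)
    rw [map_map₂_eq_mulS (f₁ := j ∘ₗ P.inX) (f₂ := j ∘ₗ P.inY) fun x y =>
      (congrArg j (P.inA_context_τA x y)).trans (hmul (P.inX x) (P.inY y))]
    exact (congrArg₂ mulS hX hY).trans ((hE _ _ _).trans hA.symm)
  τB_surj := by
    apply Submodule.map_injective_of_injective (f := j ∘ₗ P.inB) (hj.comp P.inB_injective)
    rw [map_map₂_eq_mulS (f₁ := j ∘ₗ P.inY) (f₂ := j ∘ₗ P.inX) fun y x =>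
      (congrArg j (P.inB_context_τB y x)).trans (hmul (P.inY y) (P.inX x))]
    exact (congrArg₂ mulS hY hX).trans ((hE _ _ _).trans hB.symm)

theorem map₂_context_eq {D : Submodule k A} {D' : Submodule k B}
    (h : E true false ⋆ D.map (j ∘ₗ P.inA) ⋆ E false true = D'.map (j ∘ₗ P.inB)) :
    Submodule.map₂ P.context.τB (Submodule.map₂ P.context.YA ⊤ D) ⊤ = D' := by
  apply Submodule.map_injective_of_injective (f := j ∘ₗ P.inB) (hj.comp P.inB_injective)
  rw [map_map₂_eq_mulS (f₁ := j ∘ₗ P.inY) (f₂ := j ∘ₗ P.inX) fun y x =>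
      (congrArg j (P.inB_context_τB y x)).trans (hmul (P.inY y) (P.inX x)),
    map_map₂_eq_mulS (f₁ := j ∘ₗ P.inY) (f₂ := j ∘ₗ P.inA) fun y a =>
      (congrArg j (P.inY_context_YA y a)).trans (hmul (P.inY y) (P.inA a)), hX, hY, h]

end Unital

end CornerDecomposition

/-! ### Finitely supported matrices with entries in prescribed submodules -/

section Matrices

variable {k G Z Z' : Type*} [CommRing k] [AddCommGroup Z] [Module k Z]
  [AddCommGroup Z'] [Module k Z']

/-- The finitely supported matrices `m` with `m r s ∈ W r s`. -/
def matrices (W : G → G → Submodule k Z) : Submodule k (G →₀ G →₀ Z) where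
  carrier := {m | ∀ r s, m r s ∈ W r s}
  add_mem' hm hn r s := (W r s).add_mem (hm r s) (hn r s)
  zero_mem' r s := (W r s).zero_mem
  smul_mem' l _ hm r s := (W r s).smul_mem l (hm r s)

/-- Application of a linear map to the entries of a matrix. -/
noncomputable def mapEntries (f : Z →ₗ[k] Z') : (G →₀ G →₀ Z) →ₗ[k] (G →₀ G →₀ Z') :=
  Finsupp.mapRange.linearMap (Finsupp.mapRange.linearMap f)

end Matrices

namespace Grading

section

variable {k G C Z Z' : Type*} [CommRing k] [Group G] [NonUnitalRing C] [Module k C]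
  [IsScalarTower k C C] [SMulCommClass k C C] [AddCommGroup Z] [Module k Z]
  [AddCommGroup Z'] [Module k Z']

/-- A linear map `f : Z → C` with `f(W r s) ⊆ C_{r⁻¹} C_s` maps matrices over `Z` into `I^C`. -/
noncomputable def toPartialSmash (𝒞 : Grading k G C) (W : G → G → Submodule k Z) (f : Z →ₗ[k] C)
    (hf : ∀ r s, (W r s).map f ≤ 𝒞.comp r⁻¹ ⋆ 𝒞.comp s) : matrices W →ₗ[k] 𝒞.partialSmash where
  toFun m := ⟨⟨mapEntries f m.1, fun r s =>
      𝒞.mulS_comp_le rfl (hf r s (Submodule.mem_map_of_mem (m.2 r s)))⟩,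
    fun r s => hf r s (Submodule.mem_map_of_mem (m.2 r s))⟩
  map_add' m n := Subtype.ext (Subtype.ext (map_add (mapEntries f) m.1 n.1))
  map_smul' l m := Subtype.ext (Subtype.ext (map_smul (mapEntries f) l m.1))

/-- A linear map `f : C → Z` with `f(C_{r⁻¹} C_s) ⊆ W r s` maps `I^C` to matrices over `Z`. -/
noncomputable def ofPartialSmash (𝒞 : Grading k G C) (W : G → G → Submodule k Z) (f : C →ₗ[k] Z)
    (hf : ∀ r s, (𝒞.comp r⁻¹ ⋆ 𝒞.comp s).map f ≤ W r s) : 𝒞.partialSmash →ₗ[k] matrices W where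
  toFun c := ⟨mapEntries f c.1.mat, fun r s => hf r s (Submodule.mem_map_of_mem (c.2 r s))⟩
  map_add' c d := Subtype.ext (map_add (mapEntries f) c.1.mat d.1.mat)
  map_smul' l c := Subtype.ext (map_smul (mapEntries f) l c.1.mat)

theorem toPartialSmash_entry {𝒞 : Grading k G C} {W : G → G → Submodule k Z} {f : Z →ₗ[k] C}
    (hf : ∀ r s, (W r s).map f ≤ 𝒞.comp r⁻¹ ⋆ 𝒞.comp s) (m : matrices W) (r s : G) :
    (𝒞.toPartialSmash W f hf m).1.mat.entry r s = f (m.1 r s) := rfl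

theorem ofPartialSmash_apply {𝒞 : Grading k G C} {W : G → G → Submodule k Z} {f : C →ₗ[k] Z}
    (hf : ∀ r s, (𝒞.comp r⁻¹ ⋆ 𝒞.comp s).map f ≤ W r s) (c : 𝒞.partialSmash) (r s : G) :
    (𝒞.ofPartialSmash W f hf c).1 r s = f (c.1.mat.entry r s) := rfl

theorem partialSmash_ext {𝒞 : Grading k G C} {c d : 𝒞.partialSmash}
    (h : ∀ r s, c.1.mat.entry r s = d.1.mat.entry r s) : c = d :=
  Subtype.ext (Smash.ext h)

variable {𝒞 : Grading k G C} {V : G → G → Submodule k Z} {W : G → G → Submodule k Z'}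
  {f : Z →ₗ[k] C} {g : Z' →ₗ[k] C}
  (hf : ∀ r s, (V r s).map f ≤ 𝒞.comp r⁻¹ ⋆ 𝒞.comp s)
  (hg : ∀ r s, (W r s).map g ≤ 𝒞.comp r⁻¹ ⋆ 𝒞.comp s)

theorem toPartialSmash_mul_entry_mem {P : Submodule k C} (h : ∀ z z', f z * g z' ∈ P)
    (m : matrices V) (n : matrices W) (r s : G) :
    (𝒞.toPartialSmash V f hf m * 𝒞.toPartialSmash W g hg n).1.mat.entry r s ∈ P :=
  Smash.mul_entry_mem fun _ => h _ _

theorem toPartialSmash_mul_eq_zero (h : ∀ z z', f z * g z' = 0)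
    (m : matrices V) (n : matrices W) :
    𝒞.toPartialSmash V f hf m * 𝒞.toPartialSmash W g hg n = 0 :=
  partialSmash_ext fun r s => (Submodule.mem_bot k).1
    (toPartialSmash_mul_entry_mem hf hg (fun z z' => (Submodule.mem_bot k).2 (h z z')) m n r s)

/-- An entry of the product is a finite sum of elements `f z * g z'`, so it stays in the range of
`p`, on which `p ∘ q` is the identity. This supplies the closure axioms of a corner decomposition.
-/
theorem toPartialSmash_ofPartialSmash_mul {Z'' : Type*} [AddCommGroup Z''] [Module k Z'']
    {U : G → G → Submodule k Z''} {p : Z'' →ₗ[k] C} {q : C →ₗ[k] Z''}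
    (hp : ∀ r s, (U r s).map p ≤ 𝒞.comp r⁻¹ ⋆ 𝒞.comp s)
    (hq : ∀ r s, (𝒞.comp r⁻¹ ⋆ 𝒞.comp s).map q ≤ U r s)
    (hpq : ∀ z, q (p z) = z) (h : ∀ z z', ∃ z'', p z'' = f z * g z')
    (m : matrices V) (n : matrices W) :
    𝒞.toPartialSmash U p hp (𝒞.ofPartialSmash U q hq
      (𝒞.toPartialSmash V f hf m * 𝒞.toPartialSmash W g hg n)) =
      𝒞.toPartialSmash V f hf m * 𝒞.toPartialSmash W g hg n := by
  apply partialSmash_ext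
  intro r s
  rw [toPartialSmash_entry, ofPartialSmash_apply]
  obtain ⟨z, hz⟩ := toPartialSmash_mul_entry_mem hf hg (P := LinearMap.range p) h m n r s
  rw [← hz, hpq]

/-- The linear left inverse `q` lifts all entries simultaneously and preserves finite support. -/
theorem map_toPartialSmash {q : C →ₗ[k] Z} (hq : ∀ z, q (f z) = z) {U : G → G → Submodule k Z}
    (hU : ∀ r s, U r s ≤ V r s) :
    ((matrices U).comap (matrices V).subtype).map
      (PartialActionData.incl 𝒞.partialSmash ∘ₗ 𝒞.toPartialSmash V f hf) =
      Smash.entriesIn 𝒞 fun r s => (U r s).map f := by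
  ext c
  constructor
  · rintro ⟨m, hm, rfl⟩ r s
    exact Submodule.mem_map_of_mem (hm r s)
  · intro hc
    have hm : ∀ r s, mapEntries q c.mat r s ∈ U r s := by
      intro r s
      obtain ⟨z, hz, hzc⟩ := hc r s
      change q (c.mat.entry r s) ∈ U r s
      rwa [← hzc, hq]
    refine ⟨⟨mapEntries q c.mat, fun r s => hU r s (hm r s)⟩, hm, ?_⟩
    apply Smash.ext
    intro r s
    change f (q (c.mat.entry r s)) = c.mat.entry r s
    obtain ⟨z, _, hzc⟩ := hc r s
    rw [← hzc, hq]

theorem map_toPartialSmash_top {q : C →ₗ[k] Z} (hq : ∀ z, q (f z) = z) :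
    (⊤ : Submodule k (matrices V)).map
      (PartialActionData.incl 𝒞.partialSmash ∘ₗ 𝒞.toPartialSmash V f hf) =
      Smash.entriesIn 𝒞 fun r s => (V r s).map f := by
  rw [← map_toPartialSmash hf hq (fun _ _ => le_rfl)]
  congr 1
  ext m
  exact ⟨fun _ => m.2, fun _ => trivial⟩

end

section

variable {k G B : Type*} [CommRing k] [Group G] [NonUnitalRing B] [Module k B]
  [IsScalarTower k B B] [SMulCommClass k B B]

/-- The elements of `I^B` as matrices. -/
def partialSmashEquiv (ℬ : Grading k G B) :
    ℬ.partialSmash ≃ₗ[k] matrices fun r s => ℬ.comp r⁻¹ ⋆ ℬ.comp s where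
  toFun m := ⟨m.1.mat, m.2⟩
  invFun m := ⟨⟨m.1, fun r s => ℬ.mulS_comp_le rfl (m.2 r s)⟩, m.2⟩
  map_add' _ _ := rfl
  map_smul' _ _ := rfl
  left_inv _ := rfl
  right_inv _ := rfl

variable {C : Type*} [NonUnitalRing C] [Module k C] [IsScalarTower k C C] [SMulCommClass k C C]

theorem toPartialSmash_partialSmashEquiv_mul {𝒞 : Grading k G C} {ℬ : Grading k G B}
    {f : B →ₗ[k] C} (hmul : ∀ b b', f (b * b') = f b * f b')
    (hf : ∀ r s, (ℬ.comp r⁻¹ ⋆ ℬ.comp s).map f ≤ 𝒞.comp r⁻¹ ⋆ 𝒞.comp s) (m n : ℬ.partialSmash) :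
    𝒞.toPartialSmash _ f hf (ℬ.partialSmashEquiv (m * n)) =
      𝒞.toPartialSmash _ f hf (ℬ.partialSmashEquiv m) *
        𝒞.toPartialSmash _ f hf (ℬ.partialSmashEquiv n) := by
  apply partialSmash_ext
  intro r s
  change f ((m.1.mat * n.1.mat).entry r s) = FMat.entry
    ((show FMat G C from mapEntries f m.1.mat) * (show FMat G C from mapEntries f n.1.mat)) r s
  rw [FMat.mul_entry, FMat.mul_entry, map_finsuppSum]
  simp only [hmul]
  exact (Finsupp.sum_mapRange_index (f := f) (hf := map_zero f)
    (g := (show G →₀ G →₀ B from m.1.mat) r) (h := fun u b => b * f (n.1.mat.entry u s))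
    (fun u => zero_mul _)).symm

end

end Grading

/-! ### The corners of the partial smash product of the context algebra -/

section

variable {k G ι R : Type*} [CommRing k] [Group G] [NonUnitalRing R] [Module k R]
    [IsScalarTower k R R] [SMulCommClass k R R]

/-- The entries `P_{i,i,r⁻¹} P_{i,j,s}` of the corners of a partial smash product. -/
noncomputable def smashEntries (P : ι → ι → G → Submodule k R) (i j : ι) (r s : G) :
    Submodule k R :=
  P i i r⁻¹ ⋆ P i j s

/-- The entries of the corners of the domains of the canonical partial action. -/
noncomputable def domEntries (P : ι → ι → G → Submodule k R) (t : G) (i j : ι) (r s : G) :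
    Submodule k R :=
  P i i r⁻¹ ⋆ (P i i t ⋆ (P i i t⁻¹ ⋆ P i j s))

variable {P : ι → ι → G → Submodule k R} (h : IsMatrixRep P)
include h

theorem IsMatrixRep.mul_inv_mul_le (i j l : ι) (u s : G) :
    P i j u ⋆ (P j j u⁻¹ ⋆ P j l s) ≤ P i l s := by
  rw [← mulS_assoc, ← h.one_mul' i j l s]
  exact mulS_mono (h.mul_le_of_eq (mul_inv_cancel u)) le_rfl

/-- The bound of `mul_inv_mul_le` is attained at `u = 1`; the two lemmas are the two hypotheses
needed in `entriesIn_mul`. -/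
theorem IsMatrixRep.one_mul_inv_one_mul (i j l : ι) (s : G) :
    P i j 1 ⋆ (P j j 1⁻¹ ⋆ P j l s) = P i l s := by
  rw [inv_one, h.one_mul, h.one_mul']

variable {𝒞 : Grading k G R} (hle : ∀ i j t, P i j t ≤ 𝒞.comp t)
include hle

theorem IsMatrixRep.smashEntries_le (i j : ι) (r s : G) :
    smashEntries P i j r s ≤ 𝒞.comp (r⁻¹ * s) :=
  (h.mul_le i i j _ _).trans (hle _ _ _)

theorem IsMatrixRep.domEntries_le (t : G) (i j : ι) (r s : G) :
    domEntries P t i j r s ≤ 𝒞.comp (r⁻¹ * s) := by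
  refine le_trans (mulS_mono le_rfl ?_) (h.smashEntries_le hle i j r s)
  exact h.mul_inv_mul_le i i j t s

open Grading Smash

/-- The source of unitality and of surjectivity of the traces for the context between `I^A` and
`I^B`. -/
theorem IsMatrixRep.smashEntries_mul (i j l : ι) :
    entriesIn 𝒞 (smashEntries P i j) ⋆ entriesIn 𝒞 (smashEntries P j l) =
      entriesIn 𝒞 (smashEntries P i l) := by
  apply entriesIn_mul (h.smashEntries_le hle i j) (h.smashEntries_le hle j l)
  · intro r u s
    unfold smashEntries
    rw [mulS_assoc]
    exact mulS_mono le_rfl (h.mul_inv_mul_le i j l u s)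
  · intro r s
    unfold smashEntries
    rw [mulS_assoc, h.one_mul_inv_one_mul]

theorem IsMatrixRep.smashEntries_mul_domEntries (t : G) (i j l : ι) :
    entriesIn 𝒞 (smashEntries P i j) ⋆ entriesIn 𝒞 (domEntries P t j l) =
      entriesIn 𝒞 (domEntries P t i l) := by
  -- Two applications of `mul_eq` move the inner index from `j` to `i`.
  have e : ∀ s, P i j t ⋆ (P j j t⁻¹ ⋆ P j l s) = P i i t ⋆ (P i i t⁻¹ ⋆ P i l s) := by
    intro s
    rw [← mulS_assoc, h.mul_eq i j j, mulS_assoc, h.mul_eq i j l]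
  apply entriesIn_mul (h.smashEntries_le hle i j) (h.domEntries_le hle t j l)
  · intro r u s
    unfold smashEntries domEntries
    rw [mulS_assoc, ← e, ← mulS_assoc (P j j u⁻¹), ← mulS_assoc (P i j u)]
    exact mulS_mono le_rfl (mulS_mono (h.mul_inv_mul_le i j j u t) le_rfl)
  · intro r s
    unfold smashEntries domEntries
    rw [mulS_assoc, ← e, ← mulS_assoc (P j j 1⁻¹), ← mulS_assoc (P i j 1),
      h.one_mul_inv_one_mul]

theorem IsMatrixRep.domEntries_mul_smashEntries (t : G) (i j l : ι) :
    entriesIn 𝒞 (domEntries P t i j) ⋆ entriesIn 𝒞 (smashEntries P j l) =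
      entriesIn 𝒞 (domEntries P t i l) := by
  apply entriesIn_mul (h.domEntries_le hle t i j) (h.smashEntries_le hle j l)
  · intro r u s
    unfold smashEntries domEntries
    simp only [mulS_assoc]
    exact mulS_mono le_rfl (mulS_mono le_rfl (mulS_mono le_rfl (h.mul_inv_mul_le i j l u s)))
  · intro r s
    unfold smashEntries domEntries
    simp only [mulS_assoc]
    rw [h.one_mul_inv_one_mul]

end

theorem mem_map_iff_of_injective {k M N : Type*} [CommRing k] [AddCommGroup M] [Module k M]
    [AddCommGroup N] [Module k N] {f : M →ₗ[k] N} (hf : Function.Injective f)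
    {P : Submodule k M} {x : M} : f x ∈ P.map f ↔ x ∈ P :=
  ⟨fun ⟨_, hy, e⟩ => hf e ▸ hy, Submodule.mem_map_of_mem⟩

/-! ### The corners of `I^C` and the Morita equivalence they carry. -/

namespace MoritaContext

variable {k G A B X Y : Type*} [CommRing k] [Group G]
  [NonUnitalRing A] [Module k A] [NonUnitalRing B] [Module k B]
  [AddCommGroup X] [Module k X] [AddCommGroup Y] [Module k Y]

theorem inA_injective (M : MoritaContext k A B X Y) : Function.Injective M.inA :=
  Function.LeftInverse.injective M.projA_inA
theorem inX_injective (M : MoritaContext k A B X Y) : Function.Injective M.inX :=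
  Function.LeftInverse.injective M.projX_inX
theorem inY_injective (M : MoritaContext k A B X Y) : Function.Injective M.inY :=
  Function.LeftInverse.injective M.projY_inY
theorem inB_injective (M : MoritaContext k A B X Y) : Function.Injective M.inB :=
  Function.LeftInverse.injective M.projB_inB

variable [IsScalarTower k A A] [SMulCommClass k A A] [IsScalarTower k B B] [SMulCommClass k B B]
  {M : MoritaContext k A B X Y} {𝒜 : Grading k G A} {ℬ : Grading k G B}
  {𝒳 : G → Submodule k X} {𝒴 : G → Submodule k Y}

theorem map_inA_smashEntries (r s : G) : (𝒜.comp r⁻¹ ⋆ 𝒜.comp s).map M.inA =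
    smashEntries (M.block 𝒜 ℬ 𝒳 𝒴) false false r s :=
  map_inA_mulS _ _

theorem map_inX_smashEntries (r s : G) :
    (Submodule.map₂ M.AX (𝒜.comp r⁻¹) (𝒳 s)).map M.inX =
    smashEntries (M.block 𝒜 ℬ 𝒳 𝒴) false true r s :=
  map_map₂_eq_mulS M.inX_AX _ _

theorem map_inY_smashEntries (r s : G) :
    (Submodule.map₂ M.BY (ℬ.comp r⁻¹) (𝒴 s)).map M.inY =
    smashEntries (M.block 𝒜 ℬ 𝒳 𝒴) true false r s :=
  map_map₂_eq_mulS M.inY_BY _ _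

theorem map_inB_smashEntries (r s : G) : (ℬ.comp r⁻¹ ⋆ ℬ.comp s).map M.inB =
    smashEntries (M.block 𝒜 ℬ 𝒳 𝒴) true true r s :=
  map_inB_mulS _ _

theorem map_inA_domEntries (t r s : G) :
    (𝒜.comp r⁻¹ ⋆ (𝒜.comp t ⋆ (𝒜.comp t⁻¹ ⋆ 𝒜.comp s))).map M.inA =
      domEntries (M.block 𝒜 ℬ 𝒳 𝒴) t false false r s := by
  rw [map_inA_mulS, map_inA_mulS, map_inA_mulS]
  rfl

theorem map_inB_domEntries (t r s : G) :
    (ℬ.comp r⁻¹ ⋆ (ℬ.comp t ⋆ (ℬ.comp t⁻¹ ⋆ ℬ.comp s))).map M.inB =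
      domEntries (M.block 𝒜 ℬ 𝒳 𝒴) t true true r s := by
  rw [map_inB_mulS, map_inB_mulS, map_inB_mulS]
  rfl

namespace IsGraded

variable (h : M.IsGraded 𝒜 ℬ 𝒳 𝒴)
include h

theorem smashEntries_le_mulS (i j : Bool) (r s : G) :
    smashEntries (M.block 𝒜 ℬ 𝒳 𝒴) i j r s ≤ h.grading.comp r⁻¹ ⋆ h.grading.comp s :=
  mulS_mono (h.block_le _ _ _) (h.block_le _ _ _)

theorem domEntries_le_mulS (t : G) (i j : Bool) (r s : G) :
    domEntries (M.block 𝒜 ℬ 𝒳 𝒴) t i j r s ≤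
      h.grading.comp r⁻¹ ⋆ (h.grading.comp t ⋆ (h.grading.comp t⁻¹ ⋆ h.grading.comp s)) :=
  mulS_mono (h.block_le _ _ _) (mulS_mono (h.block_le _ _ _)
    (mulS_mono (h.block_le _ _ _) (h.block_le _ _ _)))

theorem map_inA_le (r s : G) : (𝒜.comp r⁻¹ ⋆ 𝒜.comp s).map M.inA ≤
    h.grading.comp r⁻¹ ⋆ h.grading.comp s :=
  (map_inA_smashEntries r s).trans_le (h.smashEntries_le_mulS _ _ r s)

theorem map_inX_le (r s : G) : (Submodule.map₂ M.AX (𝒜.comp r⁻¹) (𝒳 s)).map M.inX ≤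
    h.grading.comp r⁻¹ ⋆ h.grading.comp s :=
  (map_inX_smashEntries r s).trans_le (h.smashEntries_le_mulS _ _ r s)

theorem map_inY_le (r s : G) : (Submodule.map₂ M.BY (ℬ.comp r⁻¹) (𝒴 s)).map M.inY ≤
    h.grading.comp r⁻¹ ⋆ h.grading.comp s :=
  (map_inY_smashEntries r s).trans_le (h.smashEntries_le_mulS _ _ r s)

theorem map_inB_le (r s : G) : (ℬ.comp r⁻¹ ⋆ ℬ.comp s).map M.inB ≤
    h.grading.comp r⁻¹ ⋆ h.grading.comp s :=
  (map_inB_smashEntries r s).trans_le (h.smashEntries_le_mulS _ _ r s)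

variable (hP : IsMatrixRep (M.block 𝒜 ℬ 𝒳 𝒴))
include hP

theorem corner_mem_smashEntries {r s : G} {c : M.ContextAlg}
    (hc : c ∈ h.grading.comp r⁻¹ ⋆ h.grading.comp s) (i j : Bool) :
    M.corner i j c ∈ smashEntries (M.block 𝒜 ℬ 𝒳 𝒴) i j r s :=
  h.mulS_comp_le_cornersIn hP _ _ hc i j

theorem corner_mem_domEntries {t r s : G} {c : M.ContextAlg}
    (hc : c ∈ h.grading.comp r⁻¹ ⋆ (h.grading.comp t ⋆ (h.grading.comp t⁻¹ ⋆ h.grading.comp s)))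
    (i j : Bool) : M.corner i j c ∈ domEntries (M.block 𝒜 ℬ 𝒳 𝒴) t i j r s :=
  h.mulS_comp₄_le_cornersIn hP _ _ _ _ hc i j

theorem map_projA_le (r s : G) : (h.grading.comp r⁻¹ ⋆ h.grading.comp s).map M.projA ≤
    𝒜.comp r⁻¹ ⋆ 𝒜.comp s := by
  rintro _ ⟨c, hc, rfl⟩
  have hc' := h.corner_mem_smashEntries hP hc false false
  rw [← map_inA_smashEntries] at hc'
  obtain ⟨z, hz, e⟩ := hc'
  exact M.inA_injective e ▸ hz

theorem map_projX_le (r s : G) : (h.grading.comp r⁻¹ ⋆ h.grading.comp s).map M.projX ≤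
    Submodule.map₂ M.AX (𝒜.comp r⁻¹) (𝒳 s) := by
  rintro _ ⟨c, hc, rfl⟩
  have hc' := h.corner_mem_smashEntries hP hc false true
  rw [← map_inX_smashEntries] at hc'
  obtain ⟨z, hz, e⟩ := hc'
  exact M.inX_injective e ▸ hz

theorem map_projY_le (r s : G) : (h.grading.comp r⁻¹ ⋆ h.grading.comp s).map M.projY ≤
    Submodule.map₂ M.BY (ℬ.comp r⁻¹) (𝒴 s) := by
  rintro _ ⟨c, hc, rfl⟩
  have hc' := h.corner_mem_smashEntries hP hc true false
  rw [← map_inY_smashEntries] at hc'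
  obtain ⟨z, hz, e⟩ := hc'
  exact M.inY_injective e ▸ hz

theorem map_projB_le (r s : G) : (h.grading.comp r⁻¹ ⋆ h.grading.comp s).map M.projB ≤
    ℬ.comp r⁻¹ ⋆ ℬ.comp s := by
  rintro _ ⟨c, hc, rfl⟩
  have hc' := h.corner_mem_smashEntries hP hc true true
  rw [← map_inB_smashEntries] at hc'
  obtain ⟨z, hz, e⟩ := hc'
  exact M.inB_injective e ▸ hz

open Grading

/-- The partial smash product of the context algebra decomposes into corners, two of which are the
partial smash products of `A` and `B`. -/
noncomputable def cornerDecomposition :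
    CornerDecomposition k 𝒜.partialSmash ℬ.partialSmash
      (matrices fun r s => Submodule.map₂ M.AX (𝒜.comp r⁻¹) (𝒳 s))
      (matrices fun r s => Submodule.map₂ M.BY (ℬ.comp r⁻¹) (𝒴 s)) h.grading.partialSmash where
  inA := h.grading.toPartialSmash _ M.inA h.map_inA_le ∘ₗ 𝒜.partialSmashEquiv.toLinearMap
  inX := h.grading.toPartialSmash _ M.inX h.map_inX_le
  inY := h.grading.toPartialSmash _ M.inY h.map_inY_le
  inB := h.grading.toPartialSmash _ M.inB h.map_inB_le ∘ₗ ℬ.partialSmashEquiv.toLinearMap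
  projA := 𝒜.partialSmashEquiv.symm.toLinearMap ∘ₗ
    h.grading.ofPartialSmash _ M.projA (h.map_projA_le hP)
  projX := h.grading.ofPartialSmash _ M.projX (h.map_projX_le hP)
  projY := h.grading.ofPartialSmash _ M.projY (h.map_projY_le hP)
  projB := ℬ.partialSmashEquiv.symm.toLinearMap ∘ₗ
    h.grading.ofPartialSmash _ M.projB (h.map_projB_le hP)
  proj_sum a x y b := by
    refine ⟨partialSmash_ext fun r s => ?_,
      Subtype.ext (Finsupp.ext fun r => Finsupp.ext fun s => ?_),
      Subtype.ext (Finsupp.ext fun r => Finsupp.ext fun s => ?_), partialSmash_ext fun r s => ?_⟩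
    · change a.1.mat.entry r s + 0 + 0 + 0 = _
      simp
    · change 0 + x.1 r s + 0 + 0 = _
      simp
    · change 0 + 0 + y.1 r s + 0 = _
      simp
    · change 0 + 0 + 0 + b.1.mat.entry r s = _
      simp
  sum_proj c := by
    refine partialSmash_ext fun r s => ?_
    have e := M.sum_corner (c.1.mat.entry r s)
    simp only [Fintype.sum_bool] at e
    -- Entrywise the claim is `sum_corner`, up to the order in which the four corners are summed.
    refine Eq.trans (b := M.corner false false (c.1.mat.entry r s) +
      M.corner false true (c.1.mat.entry r s) + M.corner true false (c.1.mat.entry r s) +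
      M.corner true true (c.1.mat.entry r s)) rfl (Eq.trans ?_ e)
    abel
  inA_mul := toPartialSmash_partialSmashEquiv_mul M.inA_mul h.map_inA_le
  inB_mul := toPartialSmash_partialSmashEquiv_mul M.inB_mul h.map_inB_le
  AX _ _ := toPartialSmash_ofPartialSmash_mul h.map_inA_le h.map_inX_le h.map_inX_le
    (h.map_projX_le hP) M.projX_inX (fun a x => ⟨_, M.inX_AX a x⟩) _ _
  XB _ _ := toPartialSmash_ofPartialSmash_mul h.map_inX_le h.map_inB_le h.map_inX_le
    (h.map_projX_le hP) M.projX_inX (fun x b => ⟨_, M.inX_XB x b⟩) _ _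
  BY _ _ := toPartialSmash_ofPartialSmash_mul h.map_inB_le h.map_inY_le h.map_inY_le
    (h.map_projY_le hP) M.projY_inY (fun b y => ⟨_, M.inY_BY b y⟩) _ _
  YA _ _ := toPartialSmash_ofPartialSmash_mul h.map_inY_le h.map_inA_le h.map_inY_le
    (h.map_projY_le hP) M.projY_inY (fun y a => ⟨_, M.inY_YA y a⟩) _ _
  XY _ _ := toPartialSmash_ofPartialSmash_mul h.map_inX_le h.map_inY_le h.map_inA_le
    (h.map_projA_le hP) M.projA_inA (fun x y => ⟨_, M.inA_τA x y⟩) _ _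
  YX _ _ := toPartialSmash_ofPartialSmash_mul h.map_inY_le h.map_inX_le h.map_inB_le
    (h.map_projB_le hP) M.projB_inB (fun y x => ⟨_, M.inB_τB y x⟩) _ _
  AY _ _ := toPartialSmash_mul_eq_zero h.map_inA_le h.map_inY_le
    (fun _ _ => by ext <;> simp [inA_apply, inY_apply]) _ _
  AB _ _ := toPartialSmash_mul_eq_zero h.map_inA_le h.map_inB_le
    (fun _ _ => by ext <;> simp [inA_apply, inB_apply]) _ _
  XA _ _ := toPartialSmash_mul_eq_zero h.map_inX_le h.map_inA_le
    (fun _ _ => by ext <;> simp [inX_apply, inA_apply]) _ _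
  XX _ _ := toPartialSmash_mul_eq_zero h.map_inX_le h.map_inX_le
    (fun _ _ => by ext <;> simp [inX_apply]) _ _
  YY _ _ := toPartialSmash_mul_eq_zero h.map_inY_le h.map_inY_le
    (fun _ _ => by ext <;> simp [inY_apply]) _ _
  YB _ _ := toPartialSmash_mul_eq_zero h.map_inY_le h.map_inB_le
    (fun _ _ => by ext <;> simp [inY_apply, inB_apply]) _ _
  BA _ _ := toPartialSmash_mul_eq_zero h.map_inB_le h.map_inA_le
    (fun _ _ => by ext <;> simp [inB_apply, inA_apply]) _ _
  BX _ _ := toPartialSmash_mul_eq_zero h.map_inB_le h.map_inX_le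
    (fun _ _ => by ext <;> simp [inB_apply, inX_apply]) _ _

/-- The corner `I^A` of `I^C`, as a submodule of the smash product of the context algebra. -/
noncomputable def inclA : 𝒜.partialSmash →ₗ[k] h.grading.Smash :=
  PartialActionData.incl h.grading.partialSmash ∘ₗ (h.cornerDecomposition hP).inA

/-- The upper right corner of `I^C`. -/
noncomputable def inclX : (matrices fun r s => Submodule.map₂ M.AX (𝒜.comp r⁻¹) (𝒳 s)) →ₗ[k]
    h.grading.Smash :=
  PartialActionData.incl h.grading.partialSmash ∘ₗ (h.cornerDecomposition hP).inX

/-- The lower left corner of `I^C`. -/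
noncomputable def inclY : (matrices fun r s => Submodule.map₂ M.BY (ℬ.comp r⁻¹) (𝒴 s)) →ₗ[k]
    h.grading.Smash :=
  PartialActionData.incl h.grading.partialSmash ∘ₗ (h.cornerDecomposition hP).inY

/-- The corner `I^B` of `I^C`. -/
noncomputable def inclB : ℬ.partialSmash →ₗ[k] h.grading.Smash :=
  PartialActionData.incl h.grading.partialSmash ∘ₗ (h.cornerDecomposition hP).inB

open Smash

theorem map_inclA_top : (⊤ : Submodule k 𝒜.partialSmash).map (h.inclA hP) =
    entriesIn h.grading (smashEntries (M.block 𝒜 ℬ 𝒳 𝒴) false false) := by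
  have e := map_toPartialSmash_top h.map_inA_le M.projA_inA
  simp only [map_inA_smashEntries (ℬ := ℬ) (𝒳 := 𝒳) (𝒴 := 𝒴)] at e
  -- Precomposition with the bijection `partialSmashEquiv` does not change the range.
  rw [← e, ← LinearMap.range_eq_map, ← LinearMap.range_eq_map]
  exact LinearMap.range_comp_of_range_eq_top (f := 𝒜.partialSmashEquiv.toLinearMap)
    (PartialActionData.incl h.grading.partialSmash ∘ₗ
      h.grading.toPartialSmash _ M.inA h.map_inA_le) (LinearEquiv.range _)

theorem map_inclX_top : (⊤ : Submodule k (matrices _)).map (h.inclX hP) =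
    entriesIn h.grading (smashEntries (M.block 𝒜 ℬ 𝒳 𝒴) false true) := by
  have e := map_toPartialSmash_top h.map_inX_le M.projX_inX
  simp only [map_inX_smashEntries (ℬ := ℬ) (𝒳 := 𝒳) (𝒴 := 𝒴)] at e
  exact e

theorem map_inclY_top : (⊤ : Submodule k (matrices _)).map (h.inclY hP) =
    entriesIn h.grading (smashEntries (M.block 𝒜 ℬ 𝒳 𝒴) true false) := by
  have e := map_toPartialSmash_top h.map_inY_le M.projY_inY
  simp only [map_inY_smashEntries (𝒜 := 𝒜) (𝒳 := 𝒳) (𝒴 := 𝒴)] at e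
  exact e

theorem map_inclB_top : (⊤ : Submodule k ℬ.partialSmash).map (h.inclB hP) =
    entriesIn h.grading (smashEntries (M.block 𝒜 ℬ 𝒳 𝒴) true true) := by
  have e := map_toPartialSmash_top h.map_inB_le M.projB_inB
  simp only [map_inB_smashEntries (𝒜 := 𝒜) (𝒳 := 𝒳) (𝒴 := 𝒴)] at e
  rw [← e, ← LinearMap.range_eq_map, ← LinearMap.range_eq_map]
  exact LinearMap.range_comp_of_range_eq_top (f := ℬ.partialSmashEquiv.toLinearMap)
    (PartialActionData.incl h.grading.partialSmash ∘ₗ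
      h.grading.toPartialSmash _ M.inB h.map_inB_le) (LinearEquiv.range _)

theorem context_isMoritaEquivalence :
    (h.cornerDecomposition hP).context.IsMoritaEquivalence :=
  (h.cornerDecomposition hP).context_isMoritaEquivalence
    (PartialActionData.incl_injective h.grading.partialSmash)
    (PartialActionData.incl_mul h.grading.partialSmash)
    (E := fun i j => entriesIn h.grading (smashEntries (M.block 𝒜 ℬ 𝒳 𝒴) i j))
    (h.map_inclA_top hP) (h.map_inclX_top hP) (h.map_inclY_top hP) (h.map_inclB_top hP)
    (hP.smashEntries_mul h.block_le)

omit h hP in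
theorem _root_.GradedMorita.Grading.IsPartiallyStrong.mem_dom_canonicalPartialAction
    (h𝒜 : 𝒜.IsPartiallyStrong) {t : G} {a : 𝒜.partialSmash} :
    a ∈ 𝒜.canonicalPartialAction.dom t ↔ ∀ r s, a.1.mat.entry r s ∈
      𝒜.comp r⁻¹ ⋆ (𝒜.comp t ⋆ (𝒜.comp t⁻¹ ⋆ 𝒜.comp s)) := by
  change a.1 ∈ PartialActionData.restrictIdeal 𝒜.dualAction 𝒜.partialSmash t ↔ _
  rw [h𝒜.restrictIdeal_eq]
  rfl

omit h hP in
theorem _root_.GradedMorita.Grading.IsPartiallyStrong.dom_le_smash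
    (h𝒜 : 𝒜.IsPartiallyStrong) (t r s : G) :
    𝒜.comp r⁻¹ ⋆ (𝒜.comp t ⋆ (𝒜.comp t⁻¹ ⋆ 𝒜.comp s)) ≤ 𝒜.comp r⁻¹ ⋆ 𝒜.comp s := by
  rw [h𝒜.isPartialRep.mul_inv_mul_mul]
  exact mulS_mono le_rfl (𝒜.mulS_comp_le (by group))

theorem map_inclA_dom (h𝒜 : 𝒜.IsPartiallyStrong) (t : G) :
    (𝒜.canonicalPartialAction.dom t).map (h.inclA hP) =
      entriesIn h.grading (domEntries (M.block 𝒜 ℬ 𝒳 𝒴) t false false) := by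
  have e := map_toPartialSmash h.map_inA_le M.projA_inA (h𝒜.dom_le_smash t)
  simp only [map_inA_domEntries (ℬ := ℬ) (𝒳 := 𝒳) (𝒴 := 𝒴)] at e
  rw [← e]
  ext c
  constructor
  · rintro ⟨a, ha, rfl⟩
    exact ⟨𝒜.partialSmashEquiv a, h𝒜.mem_dom_canonicalPartialAction.1 ha, rfl⟩
  · rintro ⟨m, hm, rfl⟩
    exact ⟨𝒜.partialSmashEquiv.symm m, h𝒜.mem_dom_canonicalPartialAction.2 hm, rfl⟩

theorem map_inclB_dom (hℬ : ℬ.IsPartiallyStrong) (t : G) :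
    (ℬ.canonicalPartialAction.dom t).map (h.inclB hP) =
      entriesIn h.grading (domEntries (M.block 𝒜 ℬ 𝒳 𝒴) t true true) := by
  have e := map_toPartialSmash h.map_inB_le M.projB_inB (hℬ.dom_le_smash t)
  simp only [map_inB_domEntries (𝒜 := 𝒜) (𝒳 := 𝒳) (𝒴 := 𝒴)] at e
  rw [← e]
  ext c
  constructor
  · rintro ⟨a, ha, rfl⟩
    exact ⟨ℬ.partialSmashEquiv a, hℬ.mem_dom_canonicalPartialAction.1 ha, rfl⟩
  · rintro ⟨m, hm, rfl⟩
    exact ⟨ℬ.partialSmashEquiv.symm m, hℬ.mem_dom_canonicalPartialAction.2 hm, rfl⟩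

/-- The canonical partial actions of `A` and `B` are Morita equivalent via the canonical partial
action of the context algebra. -/
theorem isMoritaEquivalenceVia (h𝒜 : 𝒜.IsPartiallyStrong) (hℬ : ℬ.IsPartiallyStrong) :
    PartialActionData.IsMoritaEquivalenceVia 𝒜.canonicalPartialAction ℬ.canonicalPartialAction
      (h.cornerDecomposition hP).context
      (PartialActionData.transport (h.cornerDecomposition hP).equiv
        h.grading.canonicalPartialAction) := by
  have h𝒞 := h.grading_isPartiallyStrong hP
  refine ⟨h.context_isMoritaEquivalence hP, ?_, ?_, ?_, ?_, ?_, ?_⟩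
  · exact PartialActionData.transport_isProductPartialAction _
      (h.cornerDecomposition hP).equiv_mul h𝒞.canonicalPartialAction_isProductPartialAction
  · intro t
    refine (h.cornerDecomposition hP).map₂_context_eq
      (PartialActionData.incl_injective h.grading.partialSmash)
      (PartialActionData.incl_mul h.grading.partialSmash)
      (E := fun i j => entriesIn h.grading (smashEntries (M.block 𝒜 ℬ 𝒳 𝒴) i j))
      (h.map_inclX_top hP) (h.map_inclY_top hP) ?_
    refine Eq.trans ?_ (h.map_inclB_dom hP hℬ t).symm
    -- In `C # G`, the lower left corner times `D_t` of `I^A` gives the lower left corner of the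
    -- domain of `γ^C`; multiplication by the upper right corner then gives its lower right corner,
    -- which is `D_t` of `I^B`.
    rw [← hP.domEntries_mul_smashEntries h.block_le t true false true,
      ← hP.smashEntries_mul_domEntries h.block_le t true false false, ← h.map_inclA_dom hP h𝒜]
    rfl
  · intro t
    ext a
    change (h.cornerDecomposition hP).equiv ((h.cornerDecomposition hP).context.inA a) ∈
      h.grading.canonicalPartialAction.dom t ↔ _
    rw [CornerDecomposition.equiv_inA, h𝒞.mem_dom_canonicalPartialAction,
      h𝒜.mem_dom_canonicalPartialAction]
    refine forall₂_congr fun r s => ?_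
    rw [← mem_map_iff_of_injective M.inA_injective, map_inA_domEntries (ℬ := ℬ) (𝒳 := 𝒳)
      (𝒴 := 𝒴)]
    -- An entry coming from `A` equals its own upper left corner, so the corner computation for the
    -- domain of `γ^C` applies to it directly.
    exact ⟨fun hc => h.corner_mem_domEntries hP hc false false,
      fun hc => h.domEntries_le_mulS _ _ _ _ _ hc⟩
  · intro t
    ext b
    change (h.cornerDecomposition hP).equiv ((h.cornerDecomposition hP).context.inB b) ∈
      h.grading.canonicalPartialAction.dom t ↔ _
    rw [CornerDecomposition.equiv_inB, h𝒞.mem_dom_canonicalPartialAction,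
      hℬ.mem_dom_canonicalPartialAction]
    refine forall₂_congr fun r s => ?_
    rw [← mem_map_iff_of_injective M.inB_injective, map_inB_domEntries (𝒜 := 𝒜) (𝒳 := 𝒳)
      (𝒴 := 𝒴)]
    exact ⟨fun hc => h.corner_mem_domEntries hP hc true true,
      fun hc => h.domEntries_le_mulS _ _ _ _ _ hc⟩
  · intro t a c hc
    apply (h.cornerDecomposition hP).equiv.injective
    rw [CornerDecomposition.equiv_inA]
    refine ((h.cornerDecomposition hP).equiv.apply_symm_apply _).trans ?_
    apply partialSmash_ext
    intro r s
    -- Both actions translate the indices of a matrix, and the inclusion of the corner acts entry by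
    -- entry, so the two commute.
    change ((h.cornerDecomposition hP).equiv c.1).1.mat.entry (t⁻¹ * r) (t⁻¹ * s) = _
    rw [hc, CornerDecomposition.equiv_inA]
    rfl
  · intro t b c hc
    apply (h.cornerDecomposition hP).equiv.injective
    rw [CornerDecomposition.equiv_inB]
    refine ((h.cornerDecomposition hP).equiv.apply_symm_apply _).trans ?_
    apply partialSmash_ext
    intro r s
    change ((h.cornerDecomposition hP).equiv c.1).1.mat.entry (t⁻¹ * r) (t⁻¹ * s) = _
    rw [hc, CornerDecomposition.equiv_inB]
    rfl

end IsGraded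

end MoritaContext

end GradedMorita

theorem mainTheorem5
    {k : Type uk} {G : Type uG} {A : Type uA} {B : Type uB} {X : Type uX} {Y : Type uY}
    [CommRing k] [Group G]
    [NonUnitalRing A] [Module k A] [IsScalarTower k A A] [SMulCommClass k A A]
    [NonUnitalRing B] [Module k B] [IsScalarTower k B B] [SMulCommClass k B B]
    [AddCommGroup X] [Module k X] [AddCommGroup Y] [Module k Y]
    (𝒜 : GradedMorita.Grading k G A) (ℬ : GradedMorita.Grading k G B)
    (h𝒜 : 𝒜.IsPartiallyStrong) (hℬ : ℬ.IsPartiallyStrong)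
    (M : GradedMorita.MoritaContext k A B X Y)
    (𝒳 : G → Submodule k X) (𝒴 : G → Submodule k Y)
    (hM : M.IsStrongGradedEquivalence 𝒜 ℬ 𝒳 𝒴) :
    𝒜.canonicalPartialAction.IsProductPartialAction ∧
    ℬ.canonicalPartialAction.IsProductPartialAction ∧
    GradedMorita.PartialActionData.MoritaEquivalent.{uk, uG, max uG uA, max uG uB,
      max uG uX, max uG uY} 𝒜.canonicalPartialAction ℬ.canonicalPartialAction := by
  have hA := h𝒜.canonicalPartialAction_isProductPartialAction
  have hB := hℬ.canonicalPartialAction_isProductPartialAction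
  -- The bimodules, the context and `θ` are those of `isMoritaEquivalenceVia`: matrices over `X` and
  -- `Y`, the corners of `I^C`, and the transported `γ^C`.
  exact ⟨hA, hB, hA, hB, _, _, _, _, _, _, _, _,
    hM.isGraded.isMoritaEquivalenceVia (hM.isMatrixRep h𝒜 hℬ) h𝒜 hℬ⟩
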